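/- **Network.** Macrocell base stations (MBSs) and remote radio heads (RRHs) are located at the points of two independent homogeneous Poisson point processes $\Phi_M,\Phi_R$ in $\mathbb R^2$ with densities $\lambda_M,\lambda_R>0$. A typical user at the origin connects to its nearest base station (MBS or RRH); all expectations below are conditional on this nearest base station being an MBS, called $o\in\Phi_M$. Write $|X_{\ell,M}|$ and $|X_{j,R}|$ for the distances from the user to the MBS $\ell$ and to the RRH $j$. Each MBS has $N_M$ antennas and serves $S$ users by zero-forcing beamforming, with $1\le S\le N_M$, on a resource block shared by MBSs and RRHs. The power gains are mutually independent and independent of the locations: $g_{M}\sim\Gamma(N_M-S+1,1)$ for the beam from the serving MBS to the user, $g_{\ell}\sim\Gamma(S,1)$ for the other MBSs $\ell\in\Phi_M\setminus\{o\}$, and $g_{j}\sim\exp(1)$ for the RRHs $j\in\Phi_R$. Let $P_M,P_R>0$ be the transmit powers, $\beta>0$, $B_o>0$ the bandwidth, $N_1>0$ the noise power spectral density, and $\eta_M,\eta_R\in(2,4)$ the pathloss exponents. Put $$J_M=\sum_{\ell\in\Phi_M\setminus\{o\}}\frac{P_M}{S}g_\ell\,\beta|X_{\ell,M}|^{-\eta_M},\qquad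 J_R=\sum_{j\in\Phi_R}P_R\,g_j\,\beta|X_{j,R}|^{-\eta_R},\qquad \gamma=\frac{\frac{P_M}{S}g_M\,\beta|X_{o,M}|^{-\eta_M}}{J_M+J_R+B_oN_1}.$$ **Theorem 3.** The ergodic capacity $\bar C=\mathbb E\{\log_2(1+\gamma)\}$ of the channel between the serving MBS and the user is finite and satisfies $$\bar C\;\ge\;\log_2\bigl(1+e^{Z_3+\bar Z_4}\bigr),$$ where, with $\psi$ the digamma function, $$Z_3=\ln\Bigl(\frac{P_M}{S}\beta\Bigr)+\psi(N_M-S+1)-\frac{\eta_M}{2}\Bigl(\psi(1)-\ln\bigl(\pi(\lambda_R+\lambda_M)\bigr)\Bigr),$$ $$\bar Z_4=-\ln\bigl(\mathbb E\{J_M\}+\mathbb E\{J_R\}+B_oN_1\bigr),$$ and $$\mathbb E\{J_M\}=\frac{P_M\beta\,2\pi\lambda_M\,\Gamma\bigl(2-\frac{\eta_M}{2}\bigr)}{(\eta_M-2)(\pi\lambda_M+\pi\lambda_R)^{1-\eta_M/2}},\qquad \mathbb E\{J_R\}=\frac{P_R\beta\,2\pi\lambda_R\,\Gamma\bigl(2-\frac{\eta_R}{2}\bigr)}{(\eta_R-2)(\pi\lambda_M+\pi\lambda_R)^{1-\eta_R/2}}.$$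 -/

import Mathlib

open MeasureTheory ProbabilityTheory
open scoped ENNReal

noncomputable section

namespace HetCRAN

/-- The Euclidean plane in which base stations are deployed; the typical user sits at the origin. -/
abbrev Plane := EuclideanSpace ℝ (Fin 2)

/-- The real digamma function `ψ` (only used at positive reals, where `Complex.digamma` is real). -/
def psi (x : ℝ) : ℝ := (Complex.digamma (x : ℂ)).re

variable {Ω : Type*} [MeasurableSpace Ω]

/-- The number of points of the enumerated random configuration `X` that lie in `A`. -/
def pointCount (X : ℕ → Ω → Plane) (A : Set Plane) (ω : Ω) : ℕ∞ :=
  {n : ℕ | X n ω ∈ A}.encard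

/-- `X` is a (measurable) enumeration of the points of a homogeneous Poisson point process in the
plane with density `lam`: the numbers of points in finitely many pairwise disjoint bounded Borel
sets `A i` are independent and Poisson distributed with means `lam * |A i|`. -/
structure IsHPPP (P : Measure Ω) (lam : ℝ) (X : ℕ → Ω → Plane) : Prop where
  measurable : ∀ n, Measurable (X n)
  counts : ∀ (m : ℕ) (A : Fin m → Set Plane), (∀ i, MeasurableSet (A i)) →
    (∀ i, Bornology.IsBounded (A i)) → (∀ i j, i ≠ j → Disjoint (A i) (A j)) →
    ∀ k : Fin m → ℕ,
      P {ω | ∀ i, pointCount X (A i) ω = (k i : ℕ∞)} =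
        ENNReal.ofReal (∏ i, (Real.exp (-(lam * volume.real (A i))) *
          (lam * volume.real (A i)) ^ k i / (Nat.factorial (k i) : ℝ)))

/-- The probabilistic model for one resource block shared by both tiers.
`XM`, `XR` enumerate the MBS and RRH locations, `g0` is the power gain of the zero-forcing beam
from the serving MBS, `gM n` and `gR j` are the interfering power gains from the `n`-th MBS and the
`j`-th RRH. Each MBS has `N` antennas and serves `S` users per resource block. -/
structure IsDownlink (P : Measure Ω) (N S : ℕ) (lamM lamR : ℝ)
    (XM XR : ℕ → Ω → Plane) (g0 : Ω → ℝ) (gM gR : ℕ → Ω → ℝ) : Prop where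
  hpppM : IsHPPP P lamM XM
  hpppR : IsHPPP P lamR XR
  measurable_g0 : Measurable g0
  measurable_gM : ∀ n, Measurable (gM n)
  measurable_gR : ∀ j, Measurable (gR j)
  law_g0 : P.map g0 = gammaMeasure ((N : ℝ) - S + 1) 1
  law_gM : ∀ n, P.map (gM n) = gammaMeasure (S : ℝ) 1
  law_gR : ∀ j, P.map (gR j) = expMeasure 1
  indep_gM : iIndepFun gM P
  indep_gR : iIndepFun gR P
  indep : iIndep ![MeasurableSpace.comap (fun ω n => XM n ω) inferInstance,
    MeasurableSpace.comap (fun ω j => XR j ω) inferInstance,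
    MeasurableSpace.comap g0 inferInstance,
    MeasurableSpace.comap (fun ω n => gM n ω) inferInstance,
    MeasurableSpace.comap (fun ω j => gR j ω) inferInstance] P

/-- The index of the MBS nearest to the user (the least one in case of ties). -/
def nearest (XM : ℕ → Ω → Plane) (ω : Ω) : ℕ :=
  sInf {n : ℕ | ∀ m, ‖XM n ω‖ ≤ ‖XM m ω‖}

/-- The event that the user, who connects to the nearest base station of all, is associated with
an MBS. -/
def servedByMBS (XM XR : ℕ → Ω → Plane) : Set Ω :=
  {ω | ∃ n, (∀ m, ‖XM n ω‖ ≤ ‖XM m ω‖) ∧ ∀ j, ‖XM n ω‖ ≤ ‖XR j ω‖}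

/-- Received signal power from the serving MBS. -/
def signal (S : ℕ) (PM β ηM : ℝ) (XM : ℕ → Ω → Plane) (g0 : Ω → ℝ) (ω : Ω) : ℝ :=
  PM / S * g0 ω * β * ‖XM (nearest XM ω) ω‖ ^ (-ηM)

/-- Interference power from all MBSs except the serving one. -/
def interfM (S : ℕ) (PM β ηM : ℝ) (XM : ℕ → Ω → Plane) (gM : ℕ → Ω → ℝ) (ω : Ω) : ℝ≥0∞ :=
  ∑' n, if n = nearest XM ω then 0 else ENNReal.ofReal (PM / S * gM n ω * β * ‖XM n ω‖ ^ (-ηM))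

/-- Interference power from all RRHs. -/
def interfR (PR β ηR : ℝ) (XR : ℕ → Ω → Plane) (gR : ℕ → Ω → ℝ) (ω : Ω) : ℝ≥0∞ :=
  ∑' j, ENNReal.ofReal (PR * gR j ω * β * ‖XR j ω‖ ^ (-ηR))

/-- Signal-to-interference-plus-noise ratio of the MBS transmission, with noise power `noise`
(zero if the interference power is infinite). -/
def sinr (S : ℕ) (PM PR β ηM ηR noise : ℝ) (XM XR : ℕ → Ω → Plane)
    (g0 : Ω → ℝ) (gM gR : ℕ → Ω → ℝ) (ω : Ω) : ℝ :=
  signal S PM β ηM XM g0 ω /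
    (interfM S PM β ηM XM gM ω + interfR PR β ηR XR gR ω + ENNReal.ofReal noise).toReal

/-- Instantaneous capacity in bits/s/Hz of the channel from the serving MBS to the user. -/
def rate (S : ℕ) (PM PR β ηM ηR noise : ℝ) (XM XR : ℕ → Ω → Plane)
    (g0 : Ω → ℝ) (gM gR : ℕ → Ω → ℝ) (ω : Ω) : ℝ :=
  Real.logb 2 (1 + sinr S PM PR β ηM ηR noise XM XR g0 gM gR ω)

/-- Closed form for the mean interference from the tier with transmit power `Ptx`, density `lam`
and pathloss exponent `η`. -/
def meanInterf (Ptx β lam η lamM lamR : ℝ) : ℝ :=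
  Ptx * β * 2 * Real.pi * lam * Real.Gamma (2 - η / 2) /
    ((η - 2) * (Real.pi * lamM + Real.pi * lamR) ^ (1 - η / 2))

end HetCRAN

end

/-! ### Area coordinate, Poisson counts, and Campbell's formula on void events. -/

noncomputable section

namespace HetCRAN

open Set

/-! In the coordinate `discArea`, planar Lebesgue measure becomes Lebesgue measure on the half line,
so each tier becomes a Poisson process of constant rate there. The nearest MBS sits at area `T =
contactArea XM`, and `T > s` means, up to a null set, that the disc of area `s` is void; hence `T`
is exponential with rate `lamM`.

Independence of counts on disjoint sets gives Campbell's formula on a void event: the remaining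
points keep intensity `lam` outside the void set (`lintegral_void_tsum`). Applied to the events `T >
s`, it yields the joint intensity of the nearest point and the others, `lam e^{-lam t} dt` times
`lam dx` on `t < x` (`nearestPairMeasure_eq`); no Palm theory is needed.

The tiers are independent, so given the MBSs, association with an MBS means that no RRH lies in the
open disc of area `T`, which has probability `e^{-lamR T}`. This factor tilts the law of `T` from
rate `lamM` to rate `lamM + lamR`, with total mass `lamM / (lamM + lamR)`, the association
probability. Conditionally, both tiers then have their usual intensity beyond `T`. The gains are
independent of the locations and enter the mean interference only through their means, so each mean
is a pathloss tail integral averaged over an exponential `T`. Its convergence uses exponents above 2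
for the tail and below 4 near `T = 0`.

For signal `s` and interference plus noise `w`, the rate is `log₂ (1 + e^u)` with `u = log s - log
w`. Convexity of `log (1 + e^x)` bounds its mean below by the value at `E u`, and concavity of the
logarithm gives `E log w ≤ log E w` (`logb_one_add_exp_le_integral`). Finally `E log s` is explicit:
log-moments of gamma variables are digamma values. -/

/-- The area of the disc around the origin whose boundary passes through `x`. -/
def discArea (x : Plane) : ℝ := Real.pi * ‖x‖ ^ 2

lemma discArea_nonneg (x : Plane) : 0 ≤ discArea x := by unfold discArea; positivity

lemma measurable_discArea : Measurable discArea := by unfold discArea; fun_prop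

lemma discArea_le_iff (x y : Plane) : discArea x ≤ discArea y ↔ ‖x‖ ≤ ‖y‖ := by
  unfold discArea
  rw [mul_le_mul_iff_right₀ Real.pi_pos]
  exact pow_le_pow_iff_left₀ (norm_nonneg _) (norm_nonneg _) two_ne_zero

lemma preimage_discArea_Iic {u : ℝ} (hu : 0 ≤ u) :
    discArea ⁻¹' Iic u = Metric.closedBall 0 (√(u / Real.pi)) := by
  ext x
  simp only [mem_preimage, mem_Iic, Metric.mem_closedBall, dist_zero_right, discArea]
  rw [Real.le_sqrt (norm_nonneg _) (by positivity), le_div_iff₀ Real.pi_pos, mul_comm]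

lemma isBounded_preimage_discArea_Iic (u : ℝ) : Bornology.IsBounded (discArea ⁻¹' Iic u) := by
  refine Bornology.IsBounded.subset (t := discArea ⁻¹' Iic (max u 0)) ?_ ?_
  · rw [preimage_discArea_Iic (le_max_right _ _)]
    exact Metric.isBounded_closedBall
  · exact preimage_mono (Iic_subset_Iic.2 (le_max_left _ _))

/-- In the area coordinate, planar Lebesgue measure is Lebesgue measure on the half line. -/
lemma map_discArea_volume :
    (volume : Measure Plane).map discArea = (volume : Measure ℝ).restrict (Ici 0) := by
  have key : ∀ u : ℝ, (volume : Measure Plane).map discArea (Iic u) = ENNReal.ofReal u := by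
    intro u
    rw [Measure.map_apply measurable_discArea measurableSet_Iic]
    rcases lt_or_ge u 0 with hu | hu
    · have : discArea ⁻¹' Iic u = ∅ := by
        ext x
        simpa using hu.trans_le (discArea_nonneg x)
      rw [this, measure_empty, ENNReal.ofReal_of_nonpos hu.le]
    · rw [preimage_discArea_Iic hu, EuclideanSpace.volume_closedBall_fin_two,
        ← ENNReal.ofReal_pow (by positivity), ← ENNReal.ofReal_mul (by positivity),
        Real.sq_sqrt (by positivity), div_mul_cancel₀ _ Real.pi_ne_zero]
  -- Half lines form a π-system generating the Borel sets, and both measures are finite on each of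
  -- them.
  refine Measure.ext_of_generateFrom_of_iUnion (range Iic) (fun i : ℕ => Iic (i : ℝ))
    (by rw [← borel_eq_generateFrom_Iic]; exact BorelSpace.measurable_eq) isPiSystem_Iic ?_ ?_ ?_ ?_
  · ext x
    simpa using exists_nat_ge x
  · exact fun i => ⟨_, rfl⟩
  · intro i
    rw [key]; exact ENNReal.ofReal_ne_top
  · rintro _ ⟨u, rfl⟩
    rw [key, Measure.restrict_apply measurableSet_Iic, inter_comm, Ici_inter_Iic,
      Real.volume_Icc, sub_zero]

variable {Ω : Type*}

lemma toENNReal_pointCount (X : ℕ → Ω → Plane) (A : Set Plane) (ω : Ω) :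
    (pointCount X A ω : ℝ≥0∞) = ∑' n, A.indicator (fun _ => 1) (X n ω) := by
  have : ∀ n, A.indicator (fun _ => (1 : ℝ≥0∞)) (X n ω) =
      {n : ℕ | X n ω ∈ A}.indicator (fun _ => 1) n := fun n => by
    simp [indicator]
  simp_rw [this]
  rw [← tsum_subtype, ENNReal.tsum_set_one]
  rfl

/-- The event that no point of the configuration lies in `V`. -/
def voidEvent (X : ℕ → Ω → Plane) (V : Set Plane) : Set Ω := {ω | ∀ n, X n ω ∉ V}

lemma voidEvent_eq (X : ℕ → Ω → Plane) (V : Set Plane) :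
    voidEvent X V = {ω | pointCount X V ω = 0} := by
  ext ω
  simp [voidEvent, pointCount, Set.encard_eq_zero, Set.eq_empty_iff_forall_notMem]

variable [MeasurableSpace Ω] {P : Measure Ω} {X : ℕ → Ω → Plane} {lam : ℝ}

lemma measurable_toENNReal_pointCount (hX : ∀ n, Measurable (X n)) {A : Set Plane}
    (hA : MeasurableSet A) : Measurable fun ω => (pointCount X A ω : ℝ≥0∞) := by
  simp_rw [toENNReal_pointCount]
  exact Measurable.tsum fun n => (measurable_const.indicator hA).comp (hX n)

lemma measurableSet_pointCount_eq (hX : ∀ n, Measurable (X n)) {A : Set Plane}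
    (hA : MeasurableSet A) (k : ℕ) : MeasurableSet {ω | pointCount X A ω = k} := by
  have : {ω | pointCount X A ω = k} =
      (fun ω => (pointCount X A ω : ℝ≥0∞)) ⁻¹' {((k : ℕ∞) : ℝ≥0∞)} := by
    ext ω
    simp [ENat.toENNReal_inj, -ENat.toENNReal_coe]
  rw [this]
  exact measurable_toENNReal_pointCount hX hA (measurableSet_singleton _)

lemma measurableSet_voidEvent (hX : ∀ n, Measurable (X n)) {V : Set Plane}
    (hV : MeasurableSet V) : MeasurableSet (voidEvent X V) := by
  simp only [voidEvent, ofPred_forall]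
  exact MeasurableSet.iInter fun n => hX n hV.compl

lemma tsum_ofReal_poisson {m : ℝ} (hm : 0 ≤ m) :
    ∑' k : ℕ, ENNReal.ofReal (Real.exp (-m) * m ^ k / (Nat.factorial k : ℝ)) = 1 := by
  have hs : HasSum (fun k : ℕ => Real.exp (-m) * m ^ k / (Nat.factorial k : ℝ)) 1 :=
    hasSum_one_poissonMeasure ⟨m, hm⟩
  rw [← ENNReal.ofReal_tsum_of_nonneg (fun k => by positivity) hs.summable, hs.tsum_eq,
    ENNReal.ofReal_one]

namespace IsHPPP

/-- The only instance of the finite-dimensional laws that is needed: two disjoint sets, one of them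
void. -/
lemma measure_void_inter_count (h : IsHPPP P lam X) {V A : Set Plane} (hV : MeasurableSet V)
    (hA : MeasurableSet A) (hVb : Bornology.IsBounded V) (hAb : Bornology.IsBounded A)
    (hVA : Disjoint V A) (k : ℕ) :
    P (voidEvent X V ∩ {ω | pointCount X A ω = k}) =
      ENNReal.ofReal (Real.exp (-(lam * volume.real V)) * (Real.exp (-(lam * volume.real A)) *
          (lam * volume.real A) ^ k / (Nat.factorial k : ℝ))) := by
  have := h.counts 2 ![V, A] (by simp [Fin.forall_fin_two, hV, hA])
    (by simp [Fin.forall_fin_two, hVb, hAb])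
    (by simp [Fin.forall_fin_two, hVA, hVA.symm]) ![0, k]
  simpa [Fin.forall_fin_two, Fin.prod_univ_two, voidEvent_eq, ofPred_and, mul_div_assoc] using this

lemma measure_void (h : IsHPPP P lam X) {V : Set Plane} (hV : MeasurableSet V)
    (hVb : Bornology.IsBounded V) :
    P (voidEvent X V) = ENNReal.ofReal (Real.exp (-(lam * volume.real V))) := by
  have := h.measure_void_inter_count hV MeasurableSet.empty hVb Bornology.isBounded_empty
    (disjoint_empty V) 0
  simpa [pointCount] using this

lemma ae_pointCount_ne_top [IsProbabilityMeasure P] (h : IsHPPP P lam X) (hlam : 0 ≤ lam)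
    {A : Set Plane} (hA : MeasurableSet A) (hAb : Bornology.IsBounded A) :
    ∀ᵐ ω ∂P, pointCount X A ω ≠ ⊤ := by
  have hm := fun k => measurableSet_pointCount_eq h.measurable hA k
  -- The Poisson weights of the finite values already sum to one, which leaves no mass for an
  -- infinite count.
  have h1 : P (⋃ k : ℕ, {ω | pointCount X A ω = k}) = 1 := by
    rw [measure_iUnion _ hm]
    · have hk : ∀ k : ℕ, P {ω | pointCount X A ω = k} = ENNReal.ofReal
          (Real.exp (-(lam * volume.real A)) * (lam * volume.real A) ^ k / (Nat.factorial k : ℝ)) := by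
        intro k
        have := h.measure_void_inter_count MeasurableSet.empty hA Bornology.isBounded_empty hAb
          (empty_disjoint A) k
        simpa [voidEvent] using this
      simp_rw [hk]
      exact tsum_ofReal_poisson (mul_nonneg hlam measureReal_nonneg)
    · intro i j hij
      refine Set.disjoint_left.2 fun ω hi hj => hij ?_
      simp only [mem_ofPred_eq] at hi hj
      exact_mod_cast hi.symm.trans hj
  have h2 := (prob_compl_eq_zero_iff (MeasurableSet.iUnion hm)).2 h1
  rw [ae_iff]
  refine measure_mono_null ?_ h2
  intro ω hω
  simp only [ne_eq, not_not, mem_ofPred_eq] at hω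
  simp [hω]

end IsHPPP

/-- The mean of the Poisson distribution. -/
lemma tsum_ofReal_poisson_mul {m : ℝ} (hm : 0 ≤ m) :
    ∑' k : ℕ, ENNReal.ofReal (Real.exp (-m) * m ^ k / (Nat.factorial k : ℝ)) * k =
      ENNReal.ofReal m := by
  rw [tsum_eq_zero_add' ENNReal.summable]
  have : ∀ k : ℕ, ENNReal.ofReal (Real.exp (-m) * m ^ (k + 1) / (Nat.factorial (k + 1) : ℝ)) *
      ((k + 1 : ℕ) : ℝ≥0∞) =
      ENNReal.ofReal m * ENNReal.ofReal (Real.exp (-m) * m ^ k / (Nat.factorial k : ℝ)) := by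
    intro k
    rw [← ENNReal.ofReal_natCast, ← ENNReal.ofReal_mul (by positivity), ← ENNReal.ofReal_mul hm]
    congr 1
    rw [Nat.factorial_succ]
    push_cast
    field_simp
    ring
  simp_rw [this]
  rw [ENNReal.tsum_mul_left, tsum_ofReal_poisson hm]
  simp

namespace IsHPPP

/-- Avoiding `V` is independent of the count in a disjoint `A`, so the expectation factors; this is
Campbell's formula for indicators. -/
lemma lintegral_void_pointCount [IsProbabilityMeasure P] (h : IsHPPP P lam X) (hlam : 0 ≤ lam) {V A : Set Plane}
    (hV : MeasurableSet V)
    (hA : MeasurableSet A) (hVb : Bornology.IsBounded V) (hAb : Bornology.IsBounded A)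
    (hVA : Disjoint V A) :
    ∫⁻ ω in voidEvent X V, (pointCount X A ω : ℝ≥0∞) ∂P =
      P (voidEvent X V) * (ENNReal.ofReal lam * volume A) := by
  have hm := fun k => measurableSet_pointCount_eq h.measurable hA k
  have hae : ∀ᵐ ω ∂(P.restrict (voidEvent X V)), (pointCount X A ω : ℝ≥0∞) =
      ∑' k : ℕ, {ω | pointCount X A ω = k}.indicator (fun _ => (k : ℝ≥0∞)) ω := by
    filter_upwards [ae_restrict_of_ae (h.ae_pointCount_ne_top hlam hA hAb)] with ω hω
    obtain ⟨n, hn⟩ := ENat.ne_top_iff_exists.1 hω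
    rw [tsum_eq_single n]
    · simp [← hn]
    · intro k hk
      rw [indicator_of_notMem]
      simp only [mem_ofPred_eq, ← hn]
      exact_mod_cast hk.symm
  rw [lintegral_congr_ae hae, lintegral_tsum fun k => (measurable_const.indicator (hm k)).aemeasurable]
  have hk : ∀ k : ℕ, ∫⁻ ω in voidEvent X V,
      {ω | pointCount X A ω = k}.indicator (fun _ => (k : ℝ≥0∞)) ω ∂P =
      P (voidEvent X V) * (ENNReal.ofReal (Real.exp (-(lam * volume.real A)) *
        (lam * volume.real A) ^ k / (Nat.factorial k : ℝ)) * k) := by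
    intro k
    rw [lintegral_indicator_const (hm k), Measure.restrict_apply (hm k), inter_comm,
      h.measure_void_inter_count hV hA hVb hAb hVA, h.measure_void hV hVb,
      ENNReal.ofReal_mul (by positivity)]
    ring
  simp_rw [hk]
  rw [ENNReal.tsum_mul_left, tsum_ofReal_poisson_mul (by positivity), ENNReal.ofReal_mul hlam,
    ofReal_measureReal (hAb.measure_lt_top.ne)]

/-- Campbell's formula for a Poisson point process on the event that a bounded set is void. -/
lemma lintegral_void_tsum [IsProbabilityMeasure P] (h : IsHPPP P lam X) (hlam : 0 ≤ lam) {V : Set Plane}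
    (hV : MeasurableSet V) (hVb : Bornology.IsBounded V) {f : Plane → ℝ≥0∞} (hf : Measurable f) :
    ∫⁻ ω in voidEvent X V, ∑' n, f (X n ω) ∂P =
      P (voidEvent X V) * (ENNReal.ofReal lam * ∫⁻ x in Vᶜ, f x) := by
  set Q := P.restrict (voidEvent X V) with hQ
  -- The intensity measure of the points on the void event; Campbell's formula amounts to
  -- identifying it.
  set κ : Measure Plane := Measure.sum fun n => Q.map (X n) with hκ
  have hκA : ∀ A, MeasurableSet A → κ A =
      ∫⁻ ω in voidEvent X V, (pointCount X A ω : ℝ≥0∞) ∂P := by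
    intro A hA
    rw [hκ, Measure.sum_apply _ hA]
    simp_rw [toENNReal_pointCount]
    rw [lintegral_tsum (f := fun n ω => A.indicator (fun _ => (1 : ℝ≥0∞)) (X n ω)) fun n =>
      ((measurable_const.indicator hA).comp (h.measurable n)).aemeasurable]
    congr 1
    ext n
    rw [Measure.map_apply (h.measurable n) hA, ← lintegral_indicator_one (h.measurable n hA)]
    rfl
  have hκeq : κ = (P (voidEvent X V) * ENNReal.ofReal lam) • (volume.restrict Vᶜ) := by
    -- The Poisson laws are given for bounded sets only, so the measures are compared inside each
    -- ball.
    refine (Measure.ext_iff_of_iUnion_eq_univ (Metric.iUnion_closedBall_nat (0 : Plane))).2 ?_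
    intro i
    ext A hA
    have hAi := hA.inter (Metric.isClosed_closedBall (x := (0 : Plane)) (ε := i)).measurableSet
    have hb : Bornology.IsBounded (A ∩ Metric.closedBall (0 : Plane) i) :=
      Metric.isBounded_closedBall.subset inter_subset_right
    rw [Measure.restrict_apply hA, Measure.restrict_apply hA, hκA _ hAi, Measure.smul_apply,
      Measure.restrict_apply hAi, smul_eq_mul, mul_assoc]
    rw [← h.lintegral_void_pointCount hlam hV (hAi.inter hV.compl) hVb
      (hb.subset inter_subset_left) (disjoint_compl_right.mono_right inter_subset_right)]
    refine setLIntegral_congr_fun (measurableSet_voidEvent h.measurable hV) fun ω hω => ?_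
    -- On the void event no point lies in `V`, so cutting `V` out of the test set does not change
    -- the count and makes the two sets disjoint.
    have : {n | X n ω ∈ A ∩ Metric.closedBall (0 : Plane) i} =
        {n | X n ω ∈ A ∩ Metric.closedBall (0 : Plane) i ∩ Vᶜ} := by
      ext n
      have := hω n
      simp [this]
    simp only [pointCount, this]
  rw [lintegral_tsum (f := fun n ω => f (X n ω)) fun n =>
    (hf.comp (h.measurable n)).aemeasurable]
  have : ∀ n, ∫⁻ ω, f (X n ω) ∂Q = ∫⁻ x, f x ∂(Q.map (X n)) := fun n =>
    (lintegral_map hf (h.measurable n)).symm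
  simp_rw [this]
  rw [← lintegral_sum_measure, ← hκ, hκeq, lintegral_smul_measure, smul_eq_mul, mul_assoc]

lemma lintegral_void_tsum_discArea [IsProbabilityMeasure P] (h : IsHPPP P lam X) (hlam : 0 ≤ lam) {I : Set ℝ}
    (hI : MeasurableSet I) (hIb : BddAbove I) {f : ℝ → ℝ≥0∞} (hf : Measurable f) :
    ∫⁻ ω in voidEvent X (discArea ⁻¹' I), ∑' n, f (discArea (X n ω)) ∂P =
      P (voidEvent X (discArea ⁻¹' I)) * (ENNReal.ofReal lam * ∫⁻ x in Ici 0 \ I, f x) := by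
  obtain ⟨u, hu⟩ := hIb
  rw [h.lintegral_void_tsum (f := fun x => f (discArea x)) hlam (measurable_discArea hI)
    ((isBounded_preimage_discArea_Iic u).subset (preimage_mono fun x hx => hu hx))
    (hf.comp measurable_discArea), ← preimage_compl,
    ← setLIntegral_map hI.compl hf measurable_discArea, map_discArea_volume,
    Measure.restrict_restrict hI.compl, inter_comm, ← sdiff_eq]

lemma measure_void_discArea (h : IsHPPP P lam X) {I : Set ℝ}
    (hI : MeasurableSet I) (hIb : BddAbove I) :
    P (voidEvent X (discArea ⁻¹' I)) =
      ENNReal.ofReal (Real.exp (-(lam * volume.real (I ∩ Ici 0)))) := by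
  obtain ⟨u, hu⟩ := hIb
  rw [h.measure_void (measurable_discArea hI)
    ((isBounded_preimage_discArea_Iic u).subset (preimage_mono fun x hx => hu hx))]
  have : volume.real (discArea ⁻¹' I) = volume.real (I ∩ Ici 0) := by
    rw [measureReal_def, ← Measure.map_apply measurable_discArea hI, map_discArea_volume,
      Measure.restrict_apply hI, measureReal_def]
  rw [this]

end IsHPPP

end HetCRAN

end

/-! ### The nearest point and the exponential law of its area. -/

noncomputable section

namespace HetCRAN

open Set

/-- The area of the largest disc around the user that contains no point of `X` in its interior. -/
def contactArea {Ω : Type*} (X : ℕ → Ω → Plane) (ω : Ω) : ℝ := discArea (X (nearest X ω) ω)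

variable {Ω : Type*} [MeasurableSpace Ω] {P : Measure Ω} {X : ℕ → Ω → Plane} {lam : ℝ}

lemma measurable_nearest (hX : ∀ n, Measurable (X n)) : Measurable (nearest X) := by
  have hS : ∀ n, MeasurableSet {ω | ∀ m, ‖X n ω‖ ≤ ‖X m ω‖} := fun n => by
    simp only [ofPred_forall]
    exact MeasurableSet.iInter fun m => measurableSet_le (hX n).norm (hX m).norm
  refine measurable_to_countable' fun n => ?_
  -- The second piece covers configurations without a minimiser, where `sInf ∅ = 0`.
  have : nearest X ⁻¹' {n} =
      ({ω | ∀ m, ‖X n ω‖ ≤ ‖X m ω‖} ∩ ⋂ k ∈ Iio n, {ω | ∀ m, ‖X k ω‖ ≤ ‖X m ω‖}ᶜ) ∪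
      ({_ω | n = 0} ∩ ⋂ k, {ω | ∀ m, ‖X k ω‖ ≤ ‖X m ω‖}ᶜ) := by
    ext ω
    simp only [mem_preimage, mem_singleton_iff, mem_union, mem_inter_iff, mem_iInter, mem_Iio,
      mem_compl_iff]
    have e : ∀ k, ω ∈ {ω | ∀ m, ‖X k ω‖ ≤ ‖X m ω‖} ↔ k ∈ {n : ℕ | ∀ m, ‖X n ω‖ ≤ ‖X m ω‖} :=
      fun k => Iff.rfl
    simp only [e, nearest]
    generalize {n : ℕ | ∀ m, ‖X n ω‖ ≤ ‖X m ω‖} = A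
    simp only [mem_ofPred_eq]
    constructor
    · rintro rfl
      rcases A.eq_empty_or_nonempty with rfl | hA
      · simp
      · exact Or.inl ⟨Nat.sInf_mem hA, fun k hk => Nat.notMem_of_lt_sInf hk⟩
    · rintro (⟨h1, h2⟩ | ⟨rfl, h2⟩)
      · refine le_antisymm (Nat.sInf_le h1) (not_lt.1 fun hlt => h2 _ hlt (Nat.sInf_mem ⟨n, h1⟩))
      · have : A = ∅ := eq_empty_iff_forall_notMem.2 h2
        simp [this]
  rw [this]
  refine ((hS n).inter ?_).union ((MeasurableSet.const _).inter
    (MeasurableSet.iInter fun k => (hS k).compl))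
  exact MeasurableSet.biInter (to_countable _) fun k _ => (hS k).compl

lemma measurable_contactArea (hX : ∀ n, Measurable (X n)) : Measurable (contactArea X) := by
  have : Measurable fun p : ℕ × Ω => X p.1 p.2 := measurable_from_prod_countable_right hX
  exact measurable_discArea.comp (this.comp ((measurable_nearest hX).prodMk measurable_id))

namespace IsHPPP

/-- Almost surely every ball contains finitely many points, so a ball reaching the point of index
`0` contains a global minimiser of the norm. -/
lemma ae_norm_nearest_le [IsProbabilityMeasure P] (h : IsHPPP P lam X) (hlam : 0 ≤ lam) :
    ∀ᵐ ω ∂P, ∀ m, ‖X (nearest X ω) ω‖ ≤ ‖X m ω‖ := by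
  have hfin : ∀ᵐ ω ∂P, ∀ k : ℕ, pointCount X (Metric.closedBall 0 (k : ℝ)) ω ≠ ⊤ :=
    ae_all_iff.2 fun k => h.ae_pointCount_ne_top hlam Metric.isClosed_closedBall.measurableSet
      Metric.isBounded_closedBall
  filter_upwards [hfin] with ω hω
  obtain ⟨k, hk⟩ := exists_nat_ge ‖X 0 ω‖
  have hf : {n | X n ω ∈ Metric.closedBall (0 : Plane) k}.Finite := encard_ne_top_iff.1 (hω k)
  obtain ⟨n, hn, hmin⟩ := hf.exists_minimalFor (fun n => ‖X n ω‖) _ ⟨0, by simpa using hk⟩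
  have hne : {n : ℕ | ∀ m, ‖X n ω‖ ≤ ‖X m ω‖}.Nonempty := by
    refine ⟨n, fun m => ?_⟩
    by_cases hm : X m ω ∈ Metric.closedBall (0 : Plane) k
    · by_contra! hlt
      exact absurd (hmin hm hlt.le) (not_le.2 hlt)
    · simp only [Metric.mem_closedBall, dist_zero_right, not_le] at hm
      have : ‖X n ω‖ ≤ k := by simpa using hn
      exact this.trans hm.le
  exact Nat.sInf_mem hne

lemma ae_contactArea_le [IsProbabilityMeasure P] (h : IsHPPP P lam X) (hlam : 0 ≤ lam) :
    ∀ᵐ ω ∂P, ∀ m, contactArea X ω ≤ discArea (X m ω) := by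
  filter_upwards [h.ae_norm_nearest_le hlam] with ω hω m
  exact (discArea_le_iff _ _).2 (hω m)

/-- Turns statements about the nearest point into void events; the equality is only almost sure
because a minimiser may fail to exist on a null set. -/
lemma lt_contactArea_ae_eq [IsProbabilityMeasure P] (h : IsHPPP P lam X) (hlam : 0 ≤ lam) (s : ℝ) :
    {ω | s < contactArea X ω} =ᵐ[P] voidEvent X (discArea ⁻¹' Iic s) := by
  filter_upwards [h.ae_contactArea_le hlam] with ω hω
  refine propext ⟨fun hs n => ?_, fun hs => ?_⟩
  · simpa using lt_of_lt_of_le hs (hω n)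
  · exact not_le.1 (hs (nearest X ω))

lemma measure_void_Iic (h : IsHPPP P lam X) {s : ℝ} (hs : 0 ≤ s) :
    P (voidEvent X (discArea ⁻¹' Iic s)) = ENNReal.ofReal (Real.exp (-(lam * s))) := by
  rw [h.measure_void_discArea measurableSet_Iic bddAbove_Iic, inter_comm, Ici_inter_Iic]
  simp [measureReal_def, hs]

lemma measure_void_Iio (h : IsHPPP P lam X) {s : ℝ} (hs : 0 ≤ s) :
    P (voidEvent X (discArea ⁻¹' Iio s)) = ENNReal.ofReal (Real.exp (-(lam * s))) := by
  rw [h.measure_void_discArea measurableSet_Iio bddAbove_Iio, inter_comm, Ici_inter_Iio]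
  simp [measureReal_def, hs]

lemma map_contactArea [IsProbabilityMeasure P] (h : IsHPPP P lam X) (hlam : 0 < lam) :
    P.map (contactArea X) = expMeasure lam := by
  have hm := measurable_contactArea h.measurable
  have := Measure.isProbabilityMeasure_map (μ := P) hm.aemeasurable
  have := isProbabilityMeasure_expMeasure hlam
  refine Measure.ext_of_Iic _ _ fun u => ?_
  rw [← ofReal_cdf (expMeasure lam), cdf_expMeasure_eq hlam, Measure.map_apply hm measurableSet_Iic]
  split_ifs with hu
  · have hc : contactArea X ⁻¹' Iic u = {ω | u < contactArea X ω}ᶜ := by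
      ext ω; simp
    rw [hc, prob_compl_eq_one_sub (measurableSet_lt measurable_const hm),
      measure_congr (h.lt_contactArea_ae_eq hlam.le u), h.measure_void_Iic hu,
      ENNReal.ofReal_sub _ (Real.exp_nonneg _), ENNReal.ofReal_one]
  · have : contactArea X ⁻¹' Iic u = ∅ := by
      ext ω
      simpa [contactArea] using (not_le.1 hu).trans_le (discArea_nonneg (X (nearest X ω) ω))
    simp [this]

end IsHPPP

lemma expMeasure_eq_withDensity (r : ℝ) : expMeasure r =
    (volume.restrict (Ioi 0)).withDensity fun t => ENNReal.ofReal (r * Real.exp (-(r * t))) := by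
  rw [expMeasure, gammaMeasure, restrict_Ioi_eq_restrict_Ici,
    ← withDensity_indicator measurableSet_Ici]
  congr 1
  ext t
  by_cases ht : 0 ≤ t
  · simpa [ht] using! exponentialPDF_of_nonneg (r := r) ht
  · simpa [ht] using! exponentialPDF_of_neg (r := r) (not_le.1 ht)

lemma lintegral_expMeasure (r : ℝ) {f : ℝ → ℝ≥0∞} (hf : Measurable f) :
    ∫⁻ t, f t ∂(expMeasure r) =
      ∫⁻ t in Ioi 0, ENNReal.ofReal (r * Real.exp (-(r * t))) * f t := by
  rw [expMeasure_eq_withDensity, lintegral_withDensity_eq_lintegral_mul _ (by fun_prop) hf]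
  rfl

lemma ae_expMeasure_pos (r : ℝ) : ∀ᵐ t ∂(expMeasure r), 0 < t := by
  rw [expMeasure_eq_withDensity]
  exact (withDensity_absolutelyContinuous _ _).ae_le (ae_restrict_mem measurableSet_Ioi)

lemma IsHPPP.ae_contactArea_pos [IsProbabilityMeasure P] (h : IsHPPP P lam X) (hlam : 0 < lam) :
    ∀ᵐ ω ∂P, 0 < contactArea X ω := by
  have := ae_expMeasure_pos lam
  rw [← h.map_contactArea hlam] at this
  exact ae_of_ae_map (measurable_contactArea h.measurable).aemeasurable this

end HetCRAN

end

/-! ### Joint intensity of the nearest point and the other points. -/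

noncomputable section

namespace HetCRAN

open Set

variable {Ω : Type*} [MeasurableSpace Ω] {P : Measure Ω} {X : ℕ → Ω → Plane} {lam : ℝ}

/-- With the nearest point at `t`, the expected number of points up to `u` is `lam * (u - t)` others
plus the nearest itself. The integral is exact, with antiderivative `-e^{-lam t} lam (u - t)`. -/
lemma setLIntegral_Ioc_expMeasure (hlam : 0 < lam) {s : ℝ} (hs : 0 ≤ s) (u : ℝ) :
    ∫⁻ t in Ioc s u, ENNReal.ofReal (lam * (u - t) + 1) ∂(expMeasure lam) =
      ENNReal.ofReal (Real.exp (-(lam * s))) * (ENNReal.ofReal lam * ENNReal.ofReal (u - s)) := by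
  rcases le_or_gt u s with hus | hus
  · simp [Ioc_eq_empty (not_lt.2 hus), ENNReal.ofReal_of_nonpos (sub_nonpos.2 hus)]
  have hsub : Ioc s u ⊆ Ioi 0 := fun t ht => lt_of_le_of_lt hs ht.1
  rw [← lintegral_indicator measurableSet_Ioc, lintegral_expMeasure _
    (Measurable.indicator (by fun_prop) measurableSet_Ioc)]
  have h1 : ∀ t, ENNReal.ofReal (lam * Real.exp (-(lam * t))) *
      (Ioc s u).indicator (fun t => ENNReal.ofReal (lam * (u - t) + 1)) t =
      (Ioc s u).indicator (fun t => ENNReal.ofReal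
        (lam * Real.exp (-(lam * t)) * (lam * (u - t) + 1))) t := by
    intro t
    by_cases ht : t ∈ Ioc s u
    · simp only [indicator_of_mem ht]
      rw [← ENNReal.ofReal_mul (by positivity)]
    · simp [indicator_of_notMem ht]
  simp_rw [h1]
  rw [setLIntegral_indicator measurableSet_Ioc, inter_eq_left.2 hsub,
    ← ofReal_integral_eq_lintegral_ofReal, ← intervalIntegral.integral_of_le hus.le,
    ← ENNReal.ofReal_mul hlam.le, ← ENNReal.ofReal_mul (Real.exp_nonneg _)]
  · congr 1
    have hd : ∀ t ∈ uIcc s u, HasDerivAt (fun t => -Real.exp (-(lam * t)) * (lam * (u - t)))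
        (lam * Real.exp (-(lam * t)) * (lam * (u - t) + 1)) t := by
      intro t _
      have h2 : HasDerivAt (fun t => lam * (u - t)) (-lam) t := by
        simpa using ((hasDerivAt_id t).const_sub u).const_mul lam
      convert! (hasDerivAt_neg_exp_mul_exp (r := lam) (x := t)).mul h2 using 1
      ring
    rw [intervalIntegral.integral_eq_sub_of_hasDerivAt hd
      (Continuous.intervalIntegrable (by fun_prop) _ _)]
    ring
  · exact (Continuous.integrableOn_Icc (by fun_prop)).mono_set Ioc_subset_Icc_self
  · refine (ae_restrict_iff' measurableSet_Ioc).2 (ae_of_all _ fun t ht => ?_)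
    have : 0 ≤ lam * (u - t) := mul_nonneg hlam.le (sub_nonneg.2 ht.2)
    simp only [Pi.zero_apply]
    positivity

/-- The intensity measure of the pairs formed by the area of the nearest point and the area
of another point. -/
def nearestPairMeasure (P : Measure Ω) (X : ℕ → Ω → Plane) : Measure (ℝ × ℝ) :=
  Measure.sum fun n => (P.restrict {ω | n ≠ nearest X ω}).map
    fun ω => (contactArea X ω, discArea (X n ω))

lemma lintegral_nearestPairMeasure (hX : ∀ n, Measurable (X n)) {g : ℝ × ℝ → ℝ≥0∞}
    (hg : Measurable g) : ∫⁻ p, g p ∂(nearestPairMeasure P X) =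
      ∫⁻ ω, ∑' n, (if n = nearest X ω then 0 else g (contactArea X ω, discArea (X n ω))) ∂P := by
  have hm : ∀ n, Measurable fun ω => (contactArea X ω, discArea (X n ω)) := fun n =>
    (measurable_contactArea hX).prodMk (measurable_discArea.comp (hX n))
  have hs : ∀ n, MeasurableSet {ω | n = nearest X ω} := fun n =>
    measurableSet_eq_fun measurable_const (measurable_nearest hX)
  rw [nearestPairMeasure, lintegral_sum_measure, lintegral_tsum
    (f := fun n ω => if n = nearest X ω then 0 else g (contactArea X ω, discArea (X n ω))) fun n =>
    (Measurable.ite (hs n) measurable_const (hg.comp (hm n))).aemeasurable]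
  congr 1
  ext n
  have hc : MeasurableSet {ω | n ≠ nearest X ω} := (hs n).compl
  rw [lintegral_map hg (hm n), ← lintegral_indicator hc]
  refine lintegral_congr fun ω => ?_
  by_cases h : n = nearest X ω <;> simp [h]

/-- The measure `e^{-lam t} lam dt ⊗ lam dx` on `0 < t < x`. -/
def orderedPairMeasure (lam : ℝ) : Measure (ℝ × ℝ) :=
  ENNReal.ofReal lam • ((expMeasure lam).prod volume).restrict {p | p.1 < p.2}

lemma lintegral_orderedPairMeasure {g : ℝ × ℝ → ℝ≥0∞} (hg : Measurable g) :
    ∫⁻ p, g p ∂(orderedPairMeasure lam) =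
      ∫⁻ t, (ENNReal.ofReal lam * ∫⁻ x in Ioi t, g (t, x)) ∂(expMeasure lam) := by
  have hs : MeasurableSet {p : ℝ × ℝ | p.1 < p.2} := measurableSet_lt measurable_fst measurable_snd
  rw [orderedPairMeasure, lintegral_smul_measure, ← lintegral_indicator hs,
    lintegral_prod _ (hg.indicator hs).aemeasurable, smul_eq_mul,
    ← lintegral_const_mul _ (hg.indicator hs).lintegral_prod_right']
  refine lintegral_congr fun t => ?_
  rw [← lintegral_indicator measurableSet_Ioi]
  rfl

lemma indicator_rect (s u : ℝ) (p : ℝ × ℝ) :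
    (Ioi s ×ˢ Iic u).indicator (fun _ => (1 : ℝ≥0∞)) p =
      (Ioi s).indicator (fun _ => 1) p.1 * (Iic u).indicator (fun _ => 1) p.2 := by
  by_cases h1 : p.1 ∈ Ioi s <;> by_cases h2 : p.2 ∈ Iic u <;>
    simp only [indicator, mem_prod, h1, h2] <;> simp

/-- The added term restores the nearest point itself, so that the sum matches the Campbell count in
`nearestPairMeasure_rect`. -/
lemma orderedPairMeasure_rect (hlam : 0 < lam) {s : ℝ} (hs : 0 ≤ s) (u : ℝ) :
    orderedPairMeasure lam (Ioi s ×ˢ Iic u) + expMeasure lam (Ioc s u) =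
      ENNReal.ofReal (Real.exp (-(lam * s))) * (ENNReal.ofReal lam * ENNReal.ofReal (u - s)) := by
  have hR : MeasurableSet (Ioi s ×ˢ Iic u) := measurableSet_Ioi.prod measurableSet_Iic
  rw [← setLIntegral_Ioc_expMeasure hlam hs, ← lintegral_indicator_one hR,
    ← lintegral_indicator_one measurableSet_Ioc,
    lintegral_orderedPairMeasure (measurable_one.indicator hR),
    ← lintegral_add_right _ (measurable_one.indicator measurableSet_Ioc),
    ← lintegral_indicator measurableSet_Ioc]
  refine lintegral_congr fun t => ?_
  have h1 : ∫⁻ x in Ioi t, (Ioi s ×ˢ Iic u).indicator (1 : ℝ × ℝ → ℝ≥0∞) (t, x) =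
      (Ioi s).indicator (fun _ => 1) t * ENNReal.ofReal (u - t) := by
    have : ∀ x, (Ioi s ×ˢ Iic u).indicator (1 : ℝ × ℝ → ℝ≥0∞) (t, x) = _ :=
      fun x => indicator_rect s u (t, x)
    simp_rw [this]
    rw [lintegral_const_mul _ (measurable_const.indicator measurableSet_Iic),
      lintegral_indicator_const measurableSet_Iic, Measure.restrict_apply measurableSet_Iic,
      inter_comm, Ioi_inter_Iic, Real.volume_Ioc, one_mul]
  rw [h1]
  by_cases hst : s < t
  · by_cases htu : t ≤ u
    · have h0 : 0 ≤ lam * (u - t) := mul_nonneg hlam.le (sub_nonneg.2 htu)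
      simp [indicator, hst, htu, ENNReal.ofReal_add h0, ENNReal.ofReal_mul hlam.le]
    · simp [indicator, hst, htu, ENNReal.ofReal_of_nonpos (sub_nonpos.2 (not_le.1 htu).le)]
  · simp [indicator, hst]

namespace IsHPPP

variable [IsProbabilityMeasure P]

/-- On the event that the contact area exceeds `s`, the points of area at most `u` are the nearest
one, if it counts, and the others. Campbell's formula on the void disc of area `s` evaluates their
total. -/
lemma nearestPairMeasure_rect (h : IsHPPP P lam X) (hlam : 0 < lam) {s : ℝ} (hs : 0 ≤ s)
    (u : ℝ) :
    nearestPairMeasure P X (Ioi s ×ˢ Iic u) + expMeasure lam (Ioc s u) =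
      ENNReal.ofReal (Real.exp (-(lam * s))) * (ENNReal.ofReal lam * ENNReal.ofReal (u - s)) := by
  have hT := measurable_contactArea h.measurable
  have hR : MeasurableSet (Ioi s ×ˢ Iic u) := measurableSet_Ioi.prod measurableSet_Iic
  have hC := h.lintegral_void_tsum_discArea hlam.le (I := Iic s) measurableSet_Iic bddAbove_Iic
    (f := (Iic u).indicator fun _ => 1) (measurable_const.indicator measurableSet_Iic)
  rw [h.measure_void_Iic hs, lintegral_indicator_const measurableSet_Iic,
    Measure.restrict_apply measurableSet_Iic] at hC
  have hset : Iic u ∩ (Ici 0 \ Iic s) = Ioc s u := by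
    ext x
    simp only [mem_inter_iff, mem_Iic, mem_sdiff, mem_Ici, not_le, mem_Ioc]
    exact ⟨fun ⟨a, _, b⟩ => ⟨b, a⟩, fun ⟨a, b⟩ => ⟨b, hs.trans a.le, a⟩⟩
  rw [hset, Real.volume_Ioc, one_mul] at hC
  rw [← hC, ← Measure.restrict_congr_set (h.lt_contactArea_ae_eq hlam.le s),
    ← h.map_contactArea hlam, ← lintegral_indicator_one hR,
    lintegral_nearestPairMeasure h.measurable (measurable_one.indicator hR),
    ← lintegral_indicator_one measurableSet_Ioc,
    lintegral_map (measurable_one.indicator measurableSet_Ioc) hT,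
    ← lintegral_add_right (g := fun ω => (Ioc s u).indicator 1 (contactArea X ω)) _
      ((measurable_one.indicator measurableSet_Ioc).comp hT),
    ← lintegral_indicator (measurableSet_lt measurable_const hT)]
  refine lintegral_congr fun ω => ?_
  have e : ∀ n, (Ioi s ×ˢ Iic u).indicator (1 : ℝ × ℝ → ℝ≥0∞)
    (contactArea X ω, discArea (X n ω)) = _ := fun n => indicator_rect s u _
  simp_rw [e]
  by_cases hst : s < contactArea X ω
  · rw [indicator_of_mem (s := {ω | s < contactArea X ω}) hst, ENNReal.tsum_eq_add_tsum_ite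
      (f := fun n => (Iic u).indicator (fun _ => 1) (discArea (X n ω))) (nearest X ω), add_comm]
    congr 1
    · have : s < discArea (X (nearest X ω) ω) := hst
      simp [indicator, this, contactArea]
    · refine tsum_congr fun n => ?_
      by_cases hn : n = nearest X ω <;> simp [hn, hst]
  · rw [indicator_of_notMem (s := {ω | s < contactArea X ω}) hst]
    simp [indicator, hst]

/-- The joint intensity of the nearest point and the other points of a planar Poisson process,
in the area coordinate. -/
lemma nearestPairMeasure_eq (h : IsHPPP P lam X) (hlam : 0 < lam) :
    nearestPairMeasure P X = orderedPairMeasure lam := by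
  have hT := measurable_contactArea h.measurable
  have := isProbabilityMeasure_expMeasure hlam
  have hν : ∀ᵐ p ∂(nearestPairMeasure P X), 0 < p.1 := by
    refine Measure.ae_sum_iff.2 fun n => ?_
    refine (ae_map_iff (hT.prodMk (measurable_discArea.comp (h.measurable n))).aemeasurable
      (measurableSet_lt measurable_const measurable_fst)).2 ?_
    exact ae_restrict_of_ae (h.ae_contactArea_pos hlam)
  have hρ : ∀ᵐ p ∂(orderedPairMeasure lam), 0 < p.1 := by
    refine Measure.ae_smul_measure (ae_restrict_of_ae ?_) _
    exact Measure.quasiMeasurePreserving_fst.ae (ae_expMeasure_pos lam)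
  -- Both measures live on positive first coordinates, so rectangles with negative `s` reduce to `s
  -- = 0`, where the rectangle formulas apply.
  have hmax : ∀ (κ : Measure (ℝ × ℝ)), (∀ᵐ p ∂κ, 0 < p.1) → ∀ s u : ℝ,
      κ (Ioi s ×ˢ Iic u) = κ (Ioi (max s 0) ×ˢ Iic u) := by
    intro κ hκ s u
    refine measure_congr ?_
    filter_upwards [hκ] with p hp
    refine propext ⟨fun hh => ⟨max_lt hh.1 hp, hh.2⟩, fun hh => ⟨?_, hh.2⟩⟩
    exact (le_max_left s 0).trans_lt hh.1
  refine Measure.ext_of_generateFrom_of_iUnion (image2 (· ×ˢ ·) (range Ioi) (range Iic))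
    (fun i : ℕ => Ioi (-(i : ℝ)) ×ˢ Iic (i : ℝ)) ?_ (isPiSystem_Ioi.prod isPiSystem_Iic) ?_ ?_ ?_ ?_
  · refine (generateFrom_eq_prod ?_ ?_ ?_ ?_).symm
    · rw [← borel_eq_generateFrom_Ioi]; exact BorelSpace.measurable_eq.symm
    · rw [← borel_eq_generateFrom_Iic]; exact BorelSpace.measurable_eq.symm
    · exact ⟨fun i : ℕ => Ioi (-(i : ℝ)), fun i => ⟨_, rfl⟩, by
        ext x
        obtain ⟨n, hn⟩ := exists_nat_gt (-x)
        simpa using ⟨n, by linarith⟩⟩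
    · exact ⟨fun i : ℕ => Iic (i : ℝ), fun i => ⟨_, rfl⟩, by
        ext x
        simpa using exists_nat_ge x⟩
  · ext ⟨x, y⟩
    obtain ⟨n, hn⟩ := exists_nat_gt (max (-x) y)
    simp only [mem_iUnion, mem_prod, mem_Ioi, mem_Iic, mem_univ, iff_true]
    exact ⟨n, by linarith [le_max_left (-x) y], by linarith [le_max_right (-x) y]⟩
  · exact fun i => ⟨_, ⟨_, rfl⟩, _, ⟨_, rfl⟩, rfl⟩
  · intro i
    rw [hmax _ hν]
    refine ne_top_of_le_ne_top ?_ (le_add_right (c := expMeasure lam (Ioc (max (-(i : ℝ)) 0) i)) le_rfl)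
    rw [h.nearestPairMeasure_rect hlam (le_max_right _ _)]
    finiteness
  · rintro _ ⟨_, ⟨s, rfl⟩, _, ⟨u, rfl⟩, rfl⟩
    simp only
    rw [hmax _ hν, hmax _ hρ]
    -- The two rectangle formulas share the same finite added term, which cancels.
    refine (ENNReal.add_left_inj (measure_ne_top (expMeasure lam) (Ioc (max s 0) u))).1 ?_
    rw [h.nearestPairMeasure_rect hlam (le_max_right _ _),
      orderedPairMeasure_rect hlam (le_max_right _ _)]

lemma lintegral_contactArea_mul_tsum_others (h : IsHPPP P lam X) (hlam : 0 < lam)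
    {f g : ℝ → ℝ≥0∞} (hf : Measurable f) (hg : Measurable g) :
    ∫⁻ ω, g (contactArea X ω) *
        ∑' n, (if n = nearest X ω then 0 else f (discArea (X n ω))) ∂P =
      ∫⁻ t, g t * (ENNReal.ofReal lam * ∫⁻ x in Ioi t, f x) ∂(expMeasure lam) := by
  have hm : Measurable fun p : ℝ × ℝ => g p.1 * f p.2 := by fun_prop
  have h1 := lintegral_nearestPairMeasure (P := P) h.measurable hm
  rw [h.nearestPairMeasure_eq hlam, lintegral_orderedPairMeasure hm] at h1
  convert! h1.symm using 1
  · refine lintegral_congr fun ω => ?_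
    simp [← ENNReal.tsum_mul_left, mul_ite]
  · refine lintegral_congr fun t => ?_
    simp only
    rw [lintegral_const_mul _ hf]
    ring

end IsHPPP

end HetCRAN

end

/-! ### Two independent tiers and conditioning on the association event. -/

noncomputable section

namespace HetCRAN

open Set

lemma lintegral_comp_prodMk_of_indepFun {Ω α β : Type*} [MeasurableSpace Ω] [MeasurableSpace α]
    [MeasurableSpace β] {P : Measure Ω} [IsProbabilityMeasure P] {X : Ω → α} {Y : Ω → β}
    (hX : Measurable X) (hY : Measurable Y) (h : IndepFun X Y P) {F : α × β → ℝ≥0∞}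
    (hF : Measurable F) :
    ∫⁻ ω, F (X ω, Y ω) ∂P = ∫⁻ ω, ∫⁻ ω', F (X ω, Y ω') ∂P ∂P := by
  rw [← lintegral_map hF (hX.prodMk hY),
    (indepFun_iff_map_prod_eq_prod_map_map hX.aemeasurable hY.aemeasurable).1 h,
    lintegral_prod _ hF.aemeasurable, lintegral_map hF.lintegral_prod_right' hX]
  exact lintegral_congr fun ω => lintegral_map (by fun_prop) hY

/-- Tilting an exponential distribution exponentially. -/
lemma lintegral_expMeasure_tilt {a b : ℝ} (ha : 0 < a) (hb : 0 < b) {f : ℝ → ℝ≥0∞}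
    (hf : Measurable f) :
    ∫⁻ t, ENNReal.ofReal (Real.exp (-(b * t))) * f t ∂(expMeasure a) =
      ENNReal.ofReal (a / (a + b)) * ∫⁻ t, f t ∂(expMeasure (a + b)) := by
  rw [lintegral_expMeasure _ (by fun_prop), lintegral_expMeasure _ hf,
    ← lintegral_const_mul _ (by fun_prop)]
  refine lintegral_congr fun t => ?_
  rw [← mul_assoc, ← mul_assoc, ← ENNReal.ofReal_mul (by positivity),
    ← ENNReal.ofReal_mul (by positivity), mul_assoc, ← Real.exp_add, ← mul_assoc,
    div_mul_cancel₀ _ (by positivity)]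
  ring_nf

variable {Ω : Type*} [MeasurableSpace Ω] {P : Measure Ω} {XM XR : ℕ → Ω → Plane} {a b : ℝ}

/-- The nearest index depends on the sample point only through the configuration; this allows
passage to sequence space, where independence of the tiers is used. -/
lemma nearest_eval {Ω : Type*} (X : ℕ → Ω → Plane) (ω : Ω) :
    nearest (fun n (z : ℕ → Plane) => z n) (fun n => X n ω) = nearest X ω := by
  unfold nearest
  rfl

lemma contactArea_eval {Ω : Type*} (X : ℕ → Ω → Plane) (ω : Ω) :
    contactArea (fun n (z : ℕ → Plane) => z n) (fun n => X n ω) = contactArea X ω := by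
  unfold contactArea
  rw [nearest_eval]

lemma measurable_lintegral_Ioi {f : ℝ → ℝ≥0∞} (hf : Measurable f) :
    Measurable fun t : ℝ => ∫⁻ x in Ioi t, f x := by
  have hs : MeasurableSet {p : ℝ × ℝ | p.1 < p.2} := measurableSet_lt measurable_fst measurable_snd
  have := ((hf.comp measurable_snd).indicator hs).lintegral_prod_right' (ν := volume)
  convert! this using 2 with t
  rw [← lintegral_indicator measurableSet_Ioi]
  rfl

lemma measurableSet_servedByMBS (hXM : ∀ n, Measurable (XM n)) (hXR : ∀ j, Measurable (XR j)) :
    MeasurableSet (servedByMBS XM XR) := by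
  simp only [servedByMBS, ofPred_exists, ofPred_and, ofPred_forall]
  exact MeasurableSet.iUnion fun n =>
    (MeasurableSet.iInter fun m => measurableSet_le (hXM n).norm (hXM m).norm).inter
      (MeasurableSet.iInter fun j => measurableSet_le (hXM n).norm (hXR j).norm)

/-- The configurations of the two tiers for which the user is served by an MBS. -/
def servedConfigs : Set ((ℕ → Plane) × (ℕ → Plane)) :=
  servedByMBS (fun n p => p.1 n) (fun j p => p.2 j)

lemma measurableSet_servedConfigs : MeasurableSet servedConfigs :=
  measurableSet_servedByMBS (by fun_prop) (by fun_prop)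

/-- All minimisers have the same norm, so the index chosen by `nearest` may replace the existential
witness. -/
lemma mem_servedConfigs_iff {x y : ℕ → Plane}
    (hx : ∀ m, ‖x (nearest (fun n z => z n) x)‖ ≤ ‖x m‖) :
    (x, y) ∈ servedConfigs ↔ ∀ j, contactArea (fun n z => z n) x ≤ discArea (y j) := by
  simp only [contactArea, discArea_le_iff]
  constructor
  · rintro ⟨n, h1, h2⟩ j
    exact (hx n).trans (h2 j)
  · exact fun h => ⟨_, hx, h⟩

variable [IsProbabilityMeasure P]

section TwoTiers

variable (hM : IsHPPP P a XM) (hR : IsHPPP P b XR) (ha : 0 < a) (hb : 0 < b)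
  (hind : IndepFun (fun ω n => XM n ω) (fun ω j => XR j ω) P)

include hM hR ha hind

/-- Freezing the MBS configuration by independence leaves a void event of the RRH tier. The disc is
open because association allows ties. -/
lemma setLIntegral_served {G : (ℕ → Plane) × (ℕ → Plane) → ℝ≥0∞} (hG : Measurable G) :
    ∫⁻ ω in servedByMBS XM XR, G (fun n => XM n ω, fun j => XR j ω) ∂P =
      ∫⁻ ω, ∫⁻ ω' in voidEvent XR (discArea ⁻¹' Iio (contactArea XM ω)),
        G (fun n => XM n ω, fun j => XR j ω') ∂P ∂P := by
  have h := lintegral_comp_prodMk_of_indepFun (measurable_pi_lambda _ hM.measurable)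
    (measurable_pi_lambda _ hR.measurable) hind (hG.indicator measurableSet_servedConfigs)
  rw [← lintegral_indicator (measurableSet_servedByMBS hM.measurable hR.measurable)]
  refine h.trans (lintegral_congr_ae ?_)
  filter_upwards [hM.ae_norm_nearest_le ha.le] with ω hω
  rw [← lintegral_indicator (measurableSet_voidEvent hR.measurable
    (measurable_discArea measurableSet_Iio))]
  refine lintegral_congr fun ω' => ?_
  have : ((fun n => XM n ω, fun j => XR j ω') : (ℕ → Plane) × (ℕ → Plane)) ∈ servedConfigs ↔
      ω' ∈ voidEvent XR (discArea ⁻¹' Iio (contactArea XM ω)) := by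
    rw [mem_servedConfigs_iff (by rwa [nearest_eval]), contactArea_eval]
    simp only [voidEvent, mem_ofPred_eq, mem_preimage, mem_Iio, not_lt]
  by_cases h' : ω' ∈ voidEvent XR (discArea ⁻¹' Iio (contactArea XM ω))
  · rw [indicator_of_mem h', indicator_of_mem (this.2 h')]
  · rw [indicator_of_notMem h', indicator_of_notMem (mt this.1 h')]

/-- A functional of the MBSs alone sees the association event only through the RRH void probability,
an exponential weight in the contact area. -/
lemma setLIntegral_served_fst {G : (ℕ → Plane) → ℝ≥0∞} (hG : Measurable G) :
    ∫⁻ ω in servedByMBS XM XR, G (fun n => XM n ω) ∂P =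
      ∫⁻ ω, ENNReal.ofReal (Real.exp (-(b * contactArea XM ω))) * G (fun n => XM n ω) ∂P := by
  have := setLIntegral_served hM hR ha hind (hG.comp measurable_fst)
  refine this.trans (lintegral_congr fun ω => ?_)
  simp only [Function.comp_apply, lintegral_const, Measure.restrict_apply_univ]
  rw [hR.measure_void_Iio (s := contactArea XM ω) (discArea_nonneg _), mul_comm]

include hb

lemma setLIntegral_served_contactArea {f : ℝ → ℝ≥0∞} (hf : Measurable f) :
    ∫⁻ ω in servedByMBS XM XR, f (contactArea XM ω) ∂P =
      ENNReal.ofReal (a / (a + b)) * ∫⁻ t, f t ∂(expMeasure (a + b)) := by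
  have hT : Measurable (contactArea fun n (z : ℕ → Plane) => z n) :=
    measurable_contactArea (by fun_prop)
  refine (setLIntegral_served_fst hM hR ha hind (hf.comp hT)).trans ?_
  rw [← lintegral_expMeasure_tilt ha hb hf, ← hM.map_contactArea ha,
    lintegral_map (by fun_prop) (measurable_contactArea hM.measurable)]
  rfl

lemma measure_servedByMBS : P (servedByMBS XM XR) = ENNReal.ofReal (a / (a + b)) := by
  have := isProbabilityMeasure_expMeasure (add_pos ha hb)
  simpa using setLIntegral_served_contactArea hM hR ha hb hind (f := fun _ => 1) measurable_const

lemma isProbabilityMeasure_cond_served : IsProbabilityMeasure (P[|servedByMBS XM XR]) := by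
  refine cond_isProbabilityMeasure ?_
  rw [measure_servedByMBS hM hR ha hb hind]
  simp only [ne_eq, ENNReal.ofReal_eq_zero, not_le]
  positivity

/-- The factor `a / (a + b)` produced by tilting is the association probability, so conditioning
removes it. -/
lemma lintegral_cond_served (F : Ω → ℝ≥0∞) {c : ℝ≥0∞}
    (hF : ∫⁻ ω in servedByMBS XM XR, F ω ∂P = ENNReal.ofReal (a / (a + b)) * c) :
    ∫⁻ ω, F ω ∂(P[|servedByMBS XM XR]) = c := by
  have h0 : ENNReal.ofReal (a / (a + b)) ≠ 0 := by
    simp only [ne_eq, ENNReal.ofReal_eq_zero, not_le]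
    positivity
  rw [ProbabilityTheory.cond, lintegral_smul_measure, hF, measure_servedByMBS hM hR ha hb hind, smul_eq_mul,
    ← mul_assoc, ENNReal.inv_mul_cancel h0 ENNReal.ofReal_ne_top, one_mul]

/-- Given that the user is served by an MBS, the distance to the MBS is that to the nearest point
of the superposition of both tiers. -/
lemma map_contactArea_cond :
    (P[|servedByMBS XM XR]).map (contactArea XM) = expMeasure (a + b) := by
  have hT := measurable_contactArea hM.measurable
  ext A hA
  rw [← lintegral_indicator_one hA, ← lintegral_indicator_one hA,
    lintegral_map (measurable_one.indicator hA) hT]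
  exact lintegral_cond_served hM hR ha hb hind _ (setLIntegral_served_contactArea hM hR ha hb hind
    (measurable_one.indicator hA))

/-- The association weight is a function of the contact area, so the joint intensity of nearest and
other points applies, followed by the tilt. -/
lemma setLIntegral_served_tsum_others {f : ℝ → ℝ≥0∞} (hf : Measurable f) :
    ∫⁻ ω in servedByMBS XM XR,
        ∑' n, (if n = nearest XM ω then 0 else f (discArea (XM n ω))) ∂P =
      ENNReal.ofReal (a / (a + b)) *
        ∫⁻ t, (ENNReal.ofReal a * ∫⁻ x in Ioi t, f x) ∂(expMeasure (a + b)) := by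
  have hm : Measurable fun t : ℝ => ENNReal.ofReal a * ∫⁻ x in Ioi t, f x :=
    (measurable_lintegral_Ioi hf).const_mul _
  have hG : Measurable fun x : ℕ → Plane =>
      ∑' n, (if n = nearest (fun n z => z n) x then 0 else f (discArea (x n))) := by
    refine Measurable.tsum fun n => Measurable.ite (measurableSet_eq_fun measurable_const
      (measurable_nearest (by fun_prop))) measurable_const
      (hf.comp (measurable_discArea.comp (by fun_prop)))
  refine (setLIntegral_served_fst hM hR ha hind hG).trans ?_
  rw [← lintegral_expMeasure_tilt ha hb hm]
  exact hM.lintegral_contactArea_mul_tsum_others ha hf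
    (g := fun t => ENNReal.ofReal (Real.exp (-(b * t)))) (by fun_prop)

/-- Campbell's formula on the void disc supplies at once the RRH intensity beyond the contact area
and the factor `e^{-bT}` that tilts its law. -/
lemma setLIntegral_served_tsum_snd {f : ℝ → ℝ≥0∞} (hf : Measurable f) :
    ∫⁻ ω in servedByMBS XM XR, ∑' j, f (discArea (XR j ω)) ∂P =
      ENNReal.ofReal (a / (a + b)) *
        ∫⁻ t, (ENNReal.ofReal b * ∫⁻ x in Ioi t, f x) ∂(expMeasure (a + b)) := by
  have hm : Measurable fun t : ℝ => ENNReal.ofReal b * ∫⁻ x in Ioi t, f x :=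
    (measurable_lintegral_Ioi hf).const_mul _
  have hG : Measurable fun p : (ℕ → Plane) × (ℕ → Plane) => ∑' j, f (discArea (p.2 j)) :=
    Measurable.tsum fun n => hf.comp (measurable_discArea.comp (by fun_prop))
  refine (setLIntegral_served hM hR ha hind hG).trans ?_
  rw [← lintegral_expMeasure_tilt ha hb hm, ← hM.map_contactArea ha,
    lintegral_map (by fun_prop) (measurable_contactArea hM.measurable)]
  refine lintegral_congr fun ω => ?_
  have h0 : 0 ≤ contactArea XM ω := discArea_nonneg _
  rw [hR.lintegral_void_tsum_discArea hb.le measurableSet_Iio bddAbove_Iio hf,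
    hR.measure_void_Iio h0]
  have : Ici 0 \ Iio (contactArea XM ω) = Ici (contactArea XM ω) := by
    ext x
    simpa using fun hx => h0.trans hx
  rw [this, restrict_Ioi_eq_restrict_Ici]

end TwoTiers

end HetCRAN

end

/-! ### Gamma moments, log-moments, and pathloss integrals. -/

noncomputable section

namespace HetCRAN

open Set

/-- Multiplying the density of shape `a` by `x` gives `a` times the density of shape `a + 1`. -/
lemma lintegral_ofReal_gammaMeasure {a : ℝ} (ha : 0 < a) :
    ∫⁻ x, ENNReal.ofReal x ∂(gammaMeasure a 1) = ENNReal.ofReal a := by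
  have hm : ∀ c, Measurable (gammaPDF c 1) := fun c =>
    (measurable_gammaPDFReal c 1).ennreal_ofReal
  rw [gammaMeasure, lintegral_withDensity_eq_lintegral_mul _ (hm a) ENNReal.measurable_ofReal]
  have h : ∀ x, (gammaPDF a 1 * fun x => ENNReal.ofReal x) x =
      ENNReal.ofReal a * gammaPDF (a + 1) 1 x := by
    intro x
    rw [Pi.mul_apply]
    rcases lt_or_ge x 0 with hx | hx
    · simp [gammaPDF_of_neg hx]
    · have := Real.Gamma_pos_of_pos ha
      rw [gammaPDF_of_nonneg hx, gammaPDF_of_nonneg hx, ← ENNReal.ofReal_mul' hx,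
        ← ENNReal.ofReal_mul ha.le]
      congr 1
      rcases hx.eq_or_lt with rfl | hx
      · simp [ha.ne']
      rw [Real.Gamma_add_one ha.ne', add_sub_cancel_right, Real.rpow_sub_one hx.ne']
      simp only [Real.one_rpow]
      field_simp
  simp_rw [h]
  rw [lintegral_const_mul _ (hm _), lintegral_gammaPDF_eq_one (by positivity) one_pos, mul_one]

/-- The integrand is that of the derivative of the Mellin transform of `e^{-t}` at `a`. The decay
exponents `a + 1` at infinity and `0` at the origin place `a` inside the strip of differentiability.
-/
lemma integrableOn_rpow_mul_log_mul_exp {a : ℝ} (ha : 0 < a) :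
    IntegrableOn (fun t : ℝ => t ^ (a - 1) * (Real.log t * Real.exp (-t))) (Ioi 0) := by
  have hc : Continuous fun x : ℝ => ((Real.exp (-x) : ℝ) : ℂ) := by fun_prop
  have htop : (fun x : ℝ => ((Real.exp (-x) : ℝ) : ℂ)) =O[Filter.atTop] (· ^ (-(a + 1))) := by
    rw [← Asymptotics.isBigO_norm_left]
    simp_rw [Complex.norm_real, Asymptotics.isBigO_norm_left]
    simpa only [neg_one_mul] using (isLittleO_exp_neg_mul_rpow_atTop zero_lt_one _).isBigO
  have hbot : (fun x : ℝ => ((Real.exp (-x) : ℝ) : ℂ)) =O[nhdsWithin 0 (Ioi 0)] (· ^ (-(0 : ℝ))) := by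
    simp_rw [neg_zero, Real.rpow_zero]
    exact Asymptotics.isBigO_const_of_tendsto hc.continuousWithinAt (by simp)
  have h := (mellin_hasDerivAt_of_isBigO_rpow (s := (a : ℂ))
    (hc.continuousOn.locallyIntegrableOn measurableSet_Ioi) htop (by simp) hbot (by simpa)).1
  refine (integrableOn_congr_fun (fun t ht => ?_) measurableSet_Ioi).1 h.re
  have ht' : (0 : ℝ) ≤ t := le_of_lt ht
  have : (t : ℂ) ^ ((a : ℂ) - 1) = ((t ^ (a - 1) : ℝ) : ℂ) := by
    rw [Complex.ofReal_cpow ht']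
    simp
  simp only [this, smul_eq_mul, Complex.real_smul, ← Complex.ofReal_mul]
  rfl

/-- Differentiating Euler's integral under the integral sign gives `Γ'`, and the digamma function is
its logarithmic derivative. -/
lemma integral_rpow_mul_log_mul_exp {a : ℝ} (ha : 0 < a) :
    ∫ t in Ioi 0, t ^ (a - 1) * (Real.log t * Real.exp (-t)) = Real.Gamma a * psi a := by
  have hc : 0 < (a : ℂ).re := by simpa
  have hd : HasDerivAt Complex.Gamma _ (a : ℂ) :=
    (Complex.hasDerivAt_GammaIntegral hc).congr_of_eventuallyEq (by
      filter_upwards [(Complex.continuous_re.isOpen_preimage _ isOpen_Ioi).mem_nhds hc] with s hs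
      exact Complex.Gamma_eq_integral hs)
  have hint : (∫ t : ℝ in Ioi 0, (t : ℂ) ^ ((a : ℂ) - 1) * (Real.log t * Real.exp (-t))) =
      ((∫ t : ℝ in Ioi 0, t ^ (a - 1) * (Real.log t * Real.exp (-t)) : ℝ) : ℂ) := by
    rw [← integral_complex_ofReal]
    refine setIntegral_congr_fun measurableSet_Ioi fun t ht => ?_
    simp only [Complex.ofReal_mul]
    rw [Complex.ofReal_cpow (le_of_lt ht)]
    simp
  have hG := (Real.Gamma_pos_of_pos ha).ne'
  rw [psi, Complex.digamma, logDeriv_apply, hd.deriv, hint, Complex.Gamma_ofReal,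
    ← Complex.ofReal_div, Complex.ofReal_re]
  field_simp

lemma gammaMeasure_one_eq_withDensity (a : ℝ) : gammaMeasure a 1 =
    (volume.restrict (Ioi 0)).withDensity fun t =>
      ENNReal.ofReal (t ^ (a - 1) * Real.exp (-t) / Real.Gamma a) := by
  rw [gammaMeasure, restrict_Ioi_eq_restrict_Ici, ← withDensity_indicator measurableSet_Ici]
  congr 1
  ext t
  by_cases ht : 0 ≤ t
  · rw [gammaPDF_of_nonneg ht, indicator_of_mem (show t ∈ Ici 0 from ht)]
    congr 1
    rw [Real.one_rpow, one_mul]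
    ring
  · rw [gammaPDF_of_neg (not_le.1 ht), indicator_of_notMem (show t ∉ Ici 0 from ht)]

lemma ae_gammaMeasure_pos (a : ℝ) : ∀ᵐ t ∂(gammaMeasure a 1), 0 < t := by
  rw [gammaMeasure_one_eq_withDensity]
  exact (withDensity_absolutelyContinuous _ _).ae_le (ae_restrict_mem measurableSet_Ioi)

/-- The expected logarithm of a unit-rate gamma variable is the digamma function. -/
lemma integrable_log_gammaMeasure {a : ℝ} (ha : 0 < a) :
    Integrable Real.log (gammaMeasure a 1) ∧ ∫ x, Real.log x ∂(gammaMeasure a 1) = psi a := by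
  have hG := Real.Gamma_pos_of_pos ha
  have hm : Measurable fun t : ℝ => ENNReal.ofReal (t ^ (a - 1) * Real.exp (-t) / Real.Gamma a) := by
    fun_prop
  have hfin : ∀ᵐ t ∂(volume.restrict (Ioi (0 : ℝ))),
      ENNReal.ofReal (t ^ (a - 1) * Real.exp (-t) / Real.Gamma a) < ∞ :=
    ae_of_all _ fun t => ENNReal.ofReal_lt_top
  have he : ∀ t ∈ Ioi (0 : ℝ), Real.log t *
      (ENNReal.ofReal (t ^ (a - 1) * Real.exp (-t) / Real.Gamma a)).toReal =
      (Real.Gamma a)⁻¹ * (t ^ (a - 1) * (Real.log t * Real.exp (-t))) := by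
    intro t ht
    have : 0 < t := ht
    rw [ENNReal.toReal_ofReal (by positivity)]
    ring
  rw [gammaMeasure_one_eq_withDensity]
  constructor
  · rw [integrable_withDensity_iff hm hfin]
    exact (integrableOn_congr_fun he measurableSet_Ioi).2
      ((integrableOn_rpow_mul_log_mul_exp ha).const_mul _)
  · rw [integral_withDensity_eq_integral_toReal_smul hm hfin]
    simp only [smul_eq_mul, mul_comm _ (Real.log _)]
    rw [setIntegral_congr_fun measurableSet_Ioi he, integral_const_mul,
      integral_rpow_mul_log_mul_exp ha, inv_mul_cancel_left₀ hG.ne']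

lemma map_mul_expMeasure {r : ℝ} (hr : 0 < r) : (expMeasure r).map (r * ·) = expMeasure 1 := by
  have hm : Measurable fun x : ℝ => r * x := measurable_const_mul r
  have := isProbabilityMeasure_expMeasure hr
  have := isProbabilityMeasure_expMeasure one_pos
  have := Measure.isProbabilityMeasure_map (μ := expMeasure r) hm.aemeasurable
  refine Measure.ext_of_Iic _ _ fun u => ?_
  have h : (fun x : ℝ => r * x) ⁻¹' Iic u = Iic (u / r) := by
    ext x
    simp [le_div_iff₀ hr, mul_comm]
  rw [Measure.map_apply hm measurableSet_Iic, h, ← ofReal_cdf (expMeasure r),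
    ← ofReal_cdf (expMeasure 1), cdf_expMeasure_eq hr, cdf_expMeasure_eq one_pos]
  have h0 : 0 ≤ u / r ↔ 0 ≤ u := by rw [le_div_iff₀ hr, zero_mul]
  simp only [h0, mul_div_cancel₀ _ hr.ne', one_mul]

/-- Scaling by `r` reduces to rate one, which is the gamma law of shape one. -/
lemma integrable_log_expMeasure {r : ℝ} (hr : 0 < r) :
    Integrable Real.log (expMeasure r) ∧
      ∫ x, Real.log x ∂(expMeasure r) = psi 1 - Real.log r := by
  have hm : Measurable fun x : ℝ => r * x := measurable_const_mul r
  have := isProbabilityMeasure_expMeasure hr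
  obtain ⟨h1, h2⟩ := integrable_log_gammaMeasure one_pos
  change Integrable Real.log (expMeasure 1) at h1
  change ∫ x, Real.log x ∂(expMeasure 1) = psi 1 at h2
  rw [← map_mul_expMeasure hr] at h1 h2
  rw [integral_map hm.aemeasurable Real.measurable_log.aestronglyMeasurable] at h2
  have h3 : Integrable (fun x => Real.log (r * x)) (expMeasure r) :=
    (integrable_map_measure Real.measurable_log.aestronglyMeasurable hm.aemeasurable).1 h1
  have he : (fun x => Real.log (r * x) - Real.log r) =ᵐ[expMeasure r] Real.log := by
    filter_upwards [ae_expMeasure_pos r] with x hx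
    rw [Real.log_mul hr.ne' hx.ne']
    ring
  refine ⟨(h3.sub (integrable_const _)).congr he, ?_⟩
  rw [← integral_congr_ae he, integral_sub h3 (integrable_const _), h2]
  simp

lemma lintegral_Ioi_pathloss {η : ℝ} (hη : 2 < η) {t : ℝ} (ht : 0 < t) :
    ∫⁻ x in Ioi t, ENNReal.ofReal ((x / Real.pi) ^ (-(η / 2))) =
      ENNReal.ofReal (Real.pi ^ (η / 2) / (η / 2 - 1) * t ^ (1 - η / 2)) := by
  have he : ∀ x ∈ Ioi t, ENNReal.ofReal ((x / Real.pi) ^ (-(η / 2))) =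
      ENNReal.ofReal (Real.pi ^ (η / 2) * x ^ (-(η / 2))) := by
    intro x hx
    rw [Real.div_rpow (ht.trans hx).le Real.pi_pos.le, Real.rpow_neg Real.pi_pos.le (η / 2),
      div_inv_eq_mul, mul_comm]
  rw [setLIntegral_congr_fun measurableSet_Ioi he, ← ofReal_integral_eq_lintegral_ofReal,
    integral_const_mul, integral_Ioi_rpow_of_lt (by linarith) ht]
  · congr 1
    rw [show -(η / 2) + 1 = 1 - η / 2 by ring]
    have h1 : η / 2 - 1 ≠ 0 := by linarith
    have h2 : 1 - η / 2 ≠ 0 := by linarith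
    rw [show 1 - η / 2 = -(η / 2 - 1) by ring] at *
    field_simp
  · exact (integrableOn_Ioi_rpow_of_lt (by linarith) ht).const_mul _
  · refine (ae_restrict_iff' measurableSet_Ioi).2 (ae_of_all _ fun x hx => ?_)
    have : 0 < x := ht.trans hx
    simp only [Pi.zero_apply]
    positivity

/-- Used with `c = 1 - η / 2`, where `-1 < c` is exactly `η < 4`. -/
lemma lintegral_rpow_expMeasure {r c : ℝ} (hr : 0 < r) (hc : -1 < c) :
    ∫⁻ t, ENNReal.ofReal (t ^ c) ∂(expMeasure r) =
      ENNReal.ofReal (Real.Gamma (c + 1) * r ^ (-c)) := by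
  rw [lintegral_expMeasure _ (by fun_prop)]
  have he : ∀ t ∈ Ioi (0 : ℝ), ENNReal.ofReal (r * Real.exp (-(r * t))) * ENNReal.ofReal (t ^ c) =
      ENNReal.ofReal (r * (t ^ (c + 1 - 1) * Real.exp (-(r * t)))) := by
    intro t ht
    rw [← ENNReal.ofReal_mul (by positivity), add_sub_cancel_right]
    ring_nf
  have hint := Real.integral_rpow_mul_exp_neg_mul_Ioi (a := c + 1) (by linarith) hr
  rw [setLIntegral_congr_fun measurableSet_Ioi he, ← ofReal_integral_eq_lintegral_ofReal,
    integral_const_mul, hint]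
  · congr 1
    rw [one_div, Real.inv_rpow hr.le, Real.rpow_add_one hr.ne', Real.rpow_neg hr.le]
    field_simp
  · refine Integrable.const_mul (Integrable.of_integral_ne_zero ?_) _
    rw [hint]
    have := Real.Gamma_pos_of_pos (show 0 < c + 1 by linarith)
    positivity
  · refine (ae_restrict_iff' measurableSet_Ioi).2 (ae_of_all _ fun x hx => ?_)
    have : 0 < x := hx
    simp only [Pi.zero_apply]
    positivity

/-- Averages the pathloss tail beyond `t` over the conditional exponential law of the contact area;
the rest collects powers of π. -/
lemma lintegral_pathloss_eq_meanInterf {Ptx β lam η lamM lamR : ℝ} (hP : 0 < Ptx) (hβ : 0 < β)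
    (hlam : 0 < lam) (hη : 2 < η ∧ η < 4) (hM : 0 < lamM) (hR : 0 < lamR) :
    ENNReal.ofReal (Ptx * β) * ∫⁻ t, (ENNReal.ofReal lam *
      ∫⁻ x in Ioi t, ENNReal.ofReal ((x / Real.pi) ^ (-(η / 2)))) ∂(expMeasure (lamM + lamR)) =
      ENNReal.ofReal (meanInterf Ptx β lam η lamM lamR) := by
  obtain ⟨h2, h4⟩ := hη
  have hk : 0 < η / 2 - 1 := by linarith
  have hΛ : 0 < lamM + lamR := by positivity
  have he : ∀ᵐ t ∂(expMeasure (lamM + lamR)), (ENNReal.ofReal lam *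
      ∫⁻ x in Ioi t, ENNReal.ofReal ((x / Real.pi) ^ (-(η / 2)))) =
      ENNReal.ofReal (lam * (Real.pi ^ (η / 2) / (η / 2 - 1))) *
        ENNReal.ofReal (t ^ (1 - η / 2)) := by
    filter_upwards [ae_expMeasure_pos (lamM + lamR)] with t ht
    rw [lintegral_Ioi_pathloss h2 ht, ← ENNReal.ofReal_mul (by positivity),
      ← ENNReal.ofReal_mul (by positivity), mul_assoc]
  rw [lintegral_congr_ae he, lintegral_const_mul _ (by fun_prop),
    lintegral_rpow_expMeasure hΛ (by linarith), ← ENNReal.ofReal_mul (by positivity),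
    ← ENNReal.ofReal_mul (by positivity), meanInterf]
  congr 1
  rw [← mul_add, Real.mul_rpow Real.pi_pos.le hΛ.le, show 1 - η / 2 + 1 = 2 - η / 2 by ring,
    Real.rpow_neg hΛ.le, show 1 - η / 2 = -(η / 2) + 1 by ring, Real.rpow_add_one Real.pi_ne_zero,
    Real.rpow_neg Real.pi_pos.le]
  have : 0 < (lamM + lamR) ^ (-(η / 2) + 1) := by positivity
  have : 0 < Real.pi ^ (η / 2) := by positivity
  have : η - 2 ≠ 0 := by linarith
  field_simp

end HetCRAN

end

/-! ### Jensen bounds, fading gains, and the conditional signal and interference. -/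

noncomputable section

namespace HetCRAN

open Set

section Jensen

/-- A tangent line to the convex function `log (1 + exp x)`. -/
lemma log_one_add_exp_tangent (m x : ℝ) :
    Real.log (1 + Real.exp m) + Real.exp m / (1 + Real.exp m) * (x - m) ≤
      Real.log (1 + Real.exp x) := by
  have h1 : 0 < 1 + Real.exp m := by positivity
  set p := Real.exp m / (1 + Real.exp m) with hp
  have hp0 : 0 ≤ p := by positivity
  have hp1 : p ≤ 1 := by
    rw [hp, div_le_one h1]
    linarith
  -- Convexity of `exp` between `0` and `x - m` with weights `1 - p` and `p`, where `p` is the slope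
  -- of the tangent.
  have hconv := convexOn_exp.2 (mem_univ 0) (mem_univ (x - m)) (sub_nonneg.2 hp1) hp0 (by ring)
  simp only [smul_eq_mul, mul_zero, zero_add, Real.exp_zero, mul_one] at hconv
  have h2 : 1 + Real.exp x = (1 + Real.exp m) * (1 - p + p * Real.exp (x - m)) := by
    rw [Real.exp_sub, hp]
    field_simp
    ring
  have h3 : 0 < 1 - p + p * Real.exp (x - m) := (Real.exp_pos _).trans_le hconv
  rw [h2, Real.log_mul h1.ne' h3.ne']
  gcongr
  exact (Real.le_log_iff_exp_le h3).2 hconv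

variable {Ω : Type*} [MeasurableSpace Ω] {Q : Measure Ω} [IsProbabilityMeasure Q] {s w : Ω → ℝ}

/-- A lower bound for the ergodic capacity of a channel with signal power `s` and interference and
noise power `w`, by Jensen's inequality for `log (1 + exp x)` and for the logarithm. -/
lemma logb_one_add_exp_le_integral (hw : Integrable w Q) {c : ℝ} (hc : 0 < c)
    (hcw : ∀ᵐ ω ∂Q, c ≤ w ω) (hsm : AEMeasurable s Q) (hs : ∀ᵐ ω ∂Q, 0 < s ω)
    (hls : Integrable (fun ω => Real.log (s ω)) Q) :
    Integrable (fun ω => Real.logb 2 (1 + s ω / w ω)) Q ∧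
      Real.logb 2 (1 + Real.exp (∫ ω, Real.log (s ω) ∂Q + -Real.log (∫ ω, w ω ∂Q))) ≤
        ∫ ω, Real.logb 2 (1 + s ω / w ω) ∂Q := by
  -- Dominated by `w + |log c|`: the noise floor `c` bounds the logarithm below, and `log w ≤ w`
  -- bounds it above.
  have hlw : Integrable (fun ω => Real.log (w ω)) Q := by
    refine (hw.add (integrable_const |Real.log c|)).mono'
      (Real.measurable_log.comp_aemeasurable hw.aemeasurable).aestronglyMeasurable ?_
    filter_upwards [hcw] with ω hω
    have h1 := Real.log_le_log hc hω
    have h2 := Real.log_le_self (hc.le.trans hω)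
    simp only [Pi.add_apply, Real.norm_eq_abs]
    refine abs_le.2 ⟨?_, ?_⟩
    · linarith [neg_abs_le (Real.log c), hc.le.trans hω]
    · linarith [abs_nonneg (Real.log c)]
  set u : Ω → ℝ := fun ω => Real.log (s ω) - Real.log (w ω) with hu
  have hui : Integrable u Q := hls.sub hlw
  have heq : ∀ᵐ ω ∂Q, 1 + s ω / w ω = 1 + Real.exp (u ω) := by
    filter_upwards [hcw, hs] with ω hω hsω
    rw [hu, Real.exp_sub, Real.exp_log hsω, Real.exp_log (hc.trans_le hω)]
  -- Dominated by `|u| + log 2`, since `1 + e^u ≤ 2 e^|u|`.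
  have hint : Integrable (fun ω => Real.log (1 + s ω / w ω)) Q := by
    refine (hui.abs.add (integrable_const (Real.log 2))).mono'
      (Real.measurable_log.comp_aemeasurable
        ((hsm.div hw.aemeasurable).const_add _)).aestronglyMeasurable ?_
    filter_upwards [heq] with ω hω
    have hpos := Real.exp_pos (u ω)
    rw [hω, Real.norm_eq_abs, abs_of_nonneg (Real.log_nonneg (by linarith)), Pi.add_apply,
      Real.log_le_iff_le_exp (by positivity), Real.exp_add, Real.exp_log two_pos]
    have h1 : Real.exp (u ω) ≤ Real.exp |u ω| := Real.exp_le_exp.2 (le_abs_self _)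
    have h2 : 1 ≤ Real.exp |u ω| := Real.one_le_exp (abs_nonneg _)
    linarith
  refine ⟨hint.div_const _, ?_⟩
  have hwm : c ≤ ∫ ω, w ω ∂Q := by
    simpa using integral_mono_ae (integrable_const c) hw hcw
  set a := ∫ ω, w ω ∂Q with ha
  have hapos : 0 < a := hc.trans_le hwm
  -- Jensen for the logarithm, by integrating its tangent at the mean: `log w ≤ log a + w / a - 1`.
  have hJ1 : ∫ ω, Real.log (w ω) ∂Q ≤ Real.log a := by
    have : ∫ ω, Real.log (w ω) ∂Q ≤ ∫ ω, (Real.log a + (a⁻¹ * w ω - 1)) ∂Q := by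
      refine integral_mono_ae hlw
        ((integrable_const _).add ((hw.const_mul _).sub (integrable_const _))) ?_
      filter_upwards [hcw] with ω hω
      have hwpos := hc.trans_le hω
      have := Real.log_le_sub_one_of_pos (mul_pos (inv_pos.2 hapos) hwpos)
      rw [Real.log_mul (inv_ne_zero hapos.ne') hwpos.ne', Real.log_inv] at this
      linarith
    have hi : Integrable (fun ω => a⁻¹ * w ω - 1) Q := (hw.const_mul _).sub (integrable_const _)
    rw [integral_add (integrable_const _) hi,
      integral_sub (hw.const_mul _) (integrable_const _), integral_const_mul, ← ha,
      inv_mul_cancel₀ hapos.ne'] at this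
    simpa using this
  have hJ2 : Real.log (1 + Real.exp (∫ ω, u ω ∂Q)) ≤ ∫ ω, Real.log (1 + s ω / w ω) ∂Q := by
    set m := ∫ ω, u ω ∂Q with hm
    set p := Real.exp m / (1 + Real.exp m)
    have hi : Integrable (fun ω => p * (u ω - m)) Q := (hui.sub (integrable_const _)).const_mul _
    have : ∫ ω, (Real.log (1 + Real.exp m) + p * (u ω - m)) ∂Q ≤
        ∫ ω, Real.log (1 + s ω / w ω) ∂Q := by
      refine integral_mono_ae ((integrable_const _).add hi) hint ?_
      filter_upwards [heq] with ω hω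
      rw [hω]
      exact log_one_add_exp_tangent m (u ω)
    rw [integral_add (integrable_const _) hi, integral_const_mul,
      integral_sub hui (integrable_const _), ← hm] at this
    simpa using this
  have h2 : 0 < Real.log 2 := Real.log_pos one_lt_two
  simp only [Real.logb]
  rw [integral_div]
  gcongr
  refine le_trans ?_ hJ2
  rw [integral_sub hls hlw]
  gcongr
  linarith

end Jensen

lemma norm_rpow_neg_eq (x : Plane) (η : ℝ) :
    ‖x‖ ^ (-η) = (discArea x / Real.pi) ^ (-(η / 2)) := by
  rw [discArea, mul_div_cancel_left₀ _ Real.pi_ne_zero, ← Real.rpow_natCast_mul (norm_nonneg x)]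
  congr 1
  push_cast
  ring

variable {Ω : Type*} [MeasurableSpace Ω] {P : Measure Ω}

/-- The association event depends on locations only, so a gain independent of them factors out even
after restriction to it. -/
lemma setLIntegral_served_mul_gain {XM XR : ℕ → Ω → Plane} (hXM : ∀ n, Measurable (XM n))
    (hXR : ∀ j, Measurable (XR j)) {g : Ω → ℝ} (hg : Measurable g)
    (hind : IndepFun (fun ω => ((fun n => XM n ω, fun j => XR j ω) : (ℕ → Plane) × (ℕ → Plane)))
      g P) {G : (ℕ → Plane) × (ℕ → Plane) → ℝ≥0∞} (hG : Measurable G) :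
    ∫⁻ ω in servedByMBS XM XR, G (fun n => XM n ω, fun j => XR j ω) * ENNReal.ofReal (g ω) ∂P =
      (∫⁻ ω in servedByMBS XM XR, G (fun n => XM n ω, fun j => XR j ω) ∂P) *
        ∫⁻ ω, ENNReal.ofReal (g ω) ∂P := by
  have hs := measurableSet_servedByMBS hXM hXR
  have hp : Measurable fun ω => ((fun n => XM n ω, fun j => XR j ω) : (ℕ → Plane) × (ℕ → Plane)) :=
    (measurable_pi_lambda _ hXM).prodMk (measurable_pi_lambda _ hXR)
  have hG' := hG.indicator measurableSet_servedConfigs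
  have := lintegral_mul_eq_lintegral_mul_lintegral_of_indepFun'' (μ := P)
    (hG'.comp hp).aemeasurable (hg.ennreal_ofReal).aemeasurable
    (hind.comp hG' ENNReal.measurable_ofReal)
  rw [← lintegral_indicator hs, ← lintegral_indicator hs]
  refine Eq.trans (lintegral_congr fun ω => ?_) this
  rw [indicator_mul_left]
  rfl

/-- By linearity only the mean of each gain matters; independence among the gains plays no role. -/
lemma setLIntegral_served_tsum_mul_gain {XM XR : ℕ → Ω → Plane} (hXM : ∀ n, Measurable (XM n))
    (hXR : ∀ j, Measurable (XR j)) {g : ℕ → Ω → ℝ} (hg : ∀ n, Measurable (g n))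
    (hind : ∀ n, IndepFun
      (fun ω => ((fun n => XM n ω, fun j => XR j ω) : (ℕ → Plane) × (ℕ → Plane))) (g n) P)
    {c : ℝ≥0∞} (hc : ∀ n, ∫⁻ ω, ENNReal.ofReal (g n ω) ∂P = c)
    {G : ℕ → (ℕ → Plane) × (ℕ → Plane) → ℝ≥0∞} (hG : ∀ n, Measurable (G n)) :
    ∫⁻ ω in servedByMBS XM XR,
        ∑' n, G n (fun n => XM n ω, fun j => XR j ω) * ENNReal.ofReal (g n ω) ∂P =
      (∫⁻ ω in servedByMBS XM XR, ∑' n, G n (fun n => XM n ω, fun j => XR j ω) ∂P) * c := by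
  have hp : Measurable fun ω => ((fun n => XM n ω, fun j => XR j ω) : (ℕ → Plane) × (ℕ → Plane)) :=
    (measurable_pi_lambda _ hXM).prodMk (measurable_pi_lambda _ hXR)
  rw [lintegral_tsum (f := fun n ω => G n (fun n => XM n ω, fun j => XR j ω) *
      ENNReal.ofReal (g n ω)) fun n => (((hG n).comp hp).mul (hg n).ennreal_ofReal).aemeasurable,
    lintegral_tsum (f := fun n ω => G n (fun n => XM n ω, fun j => XR j ω))
      fun n => ((hG n).comp hp).aemeasurable, ← ENNReal.tsum_mul_right]
  refine tsum_congr fun n => ?_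
  rw [setLIntegral_served_mul_gain hXM hXR (hg n) (hind n) (hG n), hc n]

namespace IsDownlink

variable {N S : ℕ} {lamM lamR : ℝ} {XM XR : ℕ → Ω → Plane} {g0 : Ω → ℝ} {gM gR : ℕ → Ω → ℝ}

lemma indepFun_tiers (h : IsDownlink P N S lamM lamR XM XR g0 gM gR) :
    IndepFun (fun ω n => XM n ω) (fun ω j => XR j ω) P :=
  h.indep.indep (show (0 : Fin 5) ≠ 1 by decide)

lemma indep_locations (h : IsDownlink P N S lamM lamR XM XR g0 gM gR) {i : Fin 5}
    (hi : i ≠ 0 ∧ i ≠ 1) :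
    Indep (MeasurableSpace.comap
      (fun ω => ((fun n => XM n ω, fun j => XR j ω) : (ℕ → Plane) × (ℕ → Plane))) inferInstance)
      (![MeasurableSpace.comap (fun ω n => XM n ω) inferInstance,
        MeasurableSpace.comap (fun ω j => XR j ω) inferInstance,
        MeasurableSpace.comap g0 inferInstance,
        MeasurableSpace.comap (fun ω n => gM n ω) inferInstance,
        MeasurableSpace.comap (fun ω j => gR j ω) inferInstance] i) P := by
  have hle : ∀ i, ![MeasurableSpace.comap (fun ω n => XM n ω) inferInstance,
      MeasurableSpace.comap (fun ω j => XR j ω) inferInstance,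
      MeasurableSpace.comap g0 inferInstance,
      MeasurableSpace.comap (fun ω n => gM n ω) inferInstance,
      MeasurableSpace.comap (fun ω j => gR j ω) inferInstance] i ≤ ‹MeasurableSpace Ω› := by
    intro i
    fin_cases i
    · exact (measurable_pi_lambda _ h.hpppM.measurable).comap_le
    · exact (measurable_pi_lambda _ h.hpppR.measurable).comap_le
    · exact h.measurable_g0.comap_le
    · exact (measurable_pi_lambda _ h.measurable_gM).comap_le
    · exact (measurable_pi_lambda _ h.measurable_gR).comap_le
  -- The pair of configurations is measurable for the join of the two location σ-algebras, which is
  -- independent of the third one.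
  have := indep_iSup_of_disjoint hle h.indep (S := {0, 1}) (T := {i}) (by
    simp [hi.1, hi.2])
  rw [iSup_pair, iSup_singleton] at this
  refine indep_of_indep_of_le_left this ?_
  rw [← measurable_iff_comap_le]
  refine Measurable.prodMk ?_ ?_
  · exact measurable_iff_comap_le.2 le_sup_left
  · exact measurable_iff_comap_le.2 le_sup_right

lemma indepFun_locations_g0 (h : IsDownlink P N S lamM lamR XM XR g0 gM gR) :
    IndepFun (fun ω => ((fun n => XM n ω, fun j => XR j ω) : (ℕ → Plane) × (ℕ → Plane))) g0 P :=
  h.indep_locations (i := 2) (by decide)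

lemma indepFun_locations_gM (h : IsDownlink P N S lamM lamR XM XR g0 gM gR) (n : ℕ) :
    IndepFun (fun ω => ((fun n => XM n ω, fun j => XR j ω) : (ℕ → Plane) × (ℕ → Plane)))
      (gM n) P := by
  have : IndepFun (fun ω => ((fun n => XM n ω, fun j => XR j ω) : (ℕ → Plane) × (ℕ → Plane)))
    (fun ω n => gM n ω) P := h.indep_locations (i := 3) (by decide)
  exact this.comp measurable_id (measurable_pi_apply n)

lemma indepFun_locations_gR (h : IsDownlink P N S lamM lamR XM XR g0 gM gR) (j : ℕ) :
    IndepFun (fun ω => ((fun n => XM n ω, fun j => XR j ω) : (ℕ → Plane) × (ℕ → Plane)))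
      (gR j) P := by
  have : IndepFun (fun ω => ((fun n => XM n ω, fun j => XR j ω) : (ℕ → Plane) × (ℕ → Plane)))
    (fun ω n => gR n ω) P := h.indep_locations (i := 4) (by decide)
  exact this.comp measurable_id (measurable_pi_apply j)

variable [IsProbabilityMeasure P]

lemma lintegral_interfM (h : IsDownlink P N S lamM lamR XM XR g0 gM gR) (hS : 1 ≤ S)
    (hlamM : 0 < lamM) (hlamR : 0 < lamR) {PM β η : ℝ} (hPM : 0 < PM) (hβ : 0 < β)
    (hη : 2 < η ∧ η < 4) :
    ∫⁻ ω, interfM S PM β η XM gM ω ∂(P[|servedByMBS XM XR]) =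
      ENNReal.ofReal (meanInterf PM β lamM η lamM lamR) := by
  have hS0 : (0 : ℝ) < S := by exact_mod_cast hS
  have hf : Measurable fun x : ℝ => ENNReal.ofReal ((x / Real.pi) ^ (-(η / 2))) := by fun_prop
  refine lintegral_cond_served h.hpppM h.hpppR hlamM hlamR h.indepFun_tiers _ ?_
  have hgain : ∀ n, ∫⁻ ω, ENNReal.ofReal (gM n ω) ∂P = ENNReal.ofReal S := fun n => by
    rw [← lintegral_map ENNReal.measurable_ofReal (h.measurable_gM n), h.law_gM n,
      lintegral_ofReal_gammaMeasure hS0]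
  have hG : ∀ n, Measurable fun p : (ℕ → Plane) × (ℕ → Plane) =>
      ENNReal.ofReal (PM / S * β) * (if n = nearest (fun n z => z n) p.1 then 0 else
        ENNReal.ofReal ((discArea (p.1 n) / Real.pi) ^ (-(η / 2)))) := fun n =>
    (Measurable.ite (measurableSet_eq_fun measurable_const
      ((measurable_nearest (by fun_prop)).comp measurable_fst)) measurable_const
      (hf.comp (measurable_discArea.comp (by fun_prop)))).const_mul _
  have hmain := setLIntegral_served_tsum_mul_gain h.hpppM.measurable h.hpppR.measurable
    h.measurable_gM h.indepFun_locations_gM hgain hG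
  simp only [nearest_eval, ENNReal.tsum_mul_left] at hmain
  rw [lintegral_const_mul', setLIntegral_served_tsum_others h.hpppM h.hpppR hlamM hlamR
    h.indepFun_tiers hf] at hmain
  · rw [← lintegral_pathloss_eq_meanInterf hPM hβ hlamM hη hlamM hlamR]
    refine Eq.trans (lintegral_congr fun ω => tsum_congr fun n => ?_) (hmain.trans ?_)
    · split_ifs
      · simp
      · rw [← ENNReal.ofReal_mul (by positivity), norm_rpow_neg_eq,
          ← ENNReal.ofReal_mul (mul_nonneg (by positivity)
            (Real.rpow_nonneg (div_nonneg (discArea_nonneg _) Real.pi_pos.le) _))]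
        ring_nf
    -- The mean gain `S` cancels the power split `PM / S`.
    · have : ENNReal.ofReal (PM * β) = ENNReal.ofReal (PM / S * β) * ENNReal.ofReal S := by
        rw [← ENNReal.ofReal_mul (by positivity)]
        congr 1
        field_simp
      rw [this]
      ring
  · exact ENNReal.ofReal_ne_top

lemma lintegral_interfR (h : IsDownlink P N S lamM lamR XM XR g0 gM gR)
    (hlamM : 0 < lamM) (hlamR : 0 < lamR) {PR β η : ℝ} (hPR : 0 < PR) (hβ : 0 < β)
    (hη : 2 < η ∧ η < 4) :
    ∫⁻ ω, interfR PR β η XR gR ω ∂(P[|servedByMBS XM XR]) =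
      ENNReal.ofReal (meanInterf PR β lamR η lamM lamR) := by
  have hf : Measurable fun x : ℝ => ENNReal.ofReal ((x / Real.pi) ^ (-(η / 2))) := by fun_prop
  refine lintegral_cond_served h.hpppM h.hpppR hlamM hlamR h.indepFun_tiers _ ?_
  have hgain : ∀ n, ∫⁻ ω, ENNReal.ofReal (gR n ω) ∂P = 1 := fun n => by
    rw [← lintegral_map ENNReal.measurable_ofReal (h.measurable_gR n), h.law_gR n, expMeasure,
      lintegral_ofReal_gammaMeasure one_pos, ENNReal.ofReal_one]
  have hG : ∀ n, Measurable fun p : (ℕ → Plane) × (ℕ → Plane) =>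
      ENNReal.ofReal (PR * β) *
        ENNReal.ofReal ((discArea (p.2 n) / Real.pi) ^ (-(η / 2))) := fun n =>
    (hf.comp (measurable_discArea.comp (by fun_prop))).const_mul _
  have hmain := setLIntegral_served_tsum_mul_gain h.hpppM.measurable h.hpppR.measurable
    h.measurable_gR h.indepFun_locations_gR hgain hG
  simp only [ENNReal.tsum_mul_left] at hmain
  rw [lintegral_const_mul' _ _ ENNReal.ofReal_ne_top, setLIntegral_served_tsum_snd h.hpppM h.hpppR
    hlamM hlamR h.indepFun_tiers hf] at hmain
  rw [← lintegral_pathloss_eq_meanInterf hPR hβ hlamR hη hlamM hlamR]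
  refine Eq.trans (lintegral_congr fun ω => tsum_congr fun n => ?_) (hmain.trans ?_)
  · rw [← ENNReal.ofReal_mul (by positivity), norm_rpow_neg_eq,
      ← ENNReal.ofReal_mul (mul_nonneg (by positivity)
        (Real.rpow_nonneg (div_nonneg (discArea_nonneg _) Real.pi_pos.le) _))]
    ring_nf
  · ring

/-- The gain of the serving beam does not depend on the association event. -/
lemma map_g0_cond (h : IsDownlink P N S lamM lamR XM XR g0 gM gR)
    (hlamM : 0 < lamM) (hlamR : 0 < lamR) :
    (P[|servedByMBS XM XR]).map g0 = gammaMeasure ((N : ℝ) - S + 1) 1 := by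
  have hs := measurableSet_servedByMBS h.hpppM.measurable h.hpppR.measurable
  rw [← h.law_g0]
  ext B hB
  rw [Measure.map_apply h.measurable_g0 hB, Measure.map_apply h.measurable_g0 hB,
    cond_apply hs]
  have := h.indepFun_locations_g0.measure_inter_preimage_eq_mul _ _ measurableSet_servedConfigs hB
  refine (congrArg _ this).trans ?_
  have hP : P (servedByMBS XM XR) ≠ 0 := by
    rw [measure_servedByMBS h.hpppM h.hpppR hlamM hlamR h.indepFun_tiers]
    simp only [ne_eq, ENNReal.ofReal_eq_zero, not_le]
    positivity
  rw [← mul_assoc]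
  refine (congrArg (· * _) (ENNReal.inv_mul_cancel hP (measure_ne_top _ _))).trans (one_mul _)

/-- The expected logarithm of the received signal power. -/
lemma log_signal_integral (h : IsDownlink P N S lamM lamR XM XR g0 gM gR) (hS : 1 ≤ S)
    (hSN : S ≤ N) (hlamM : 0 < lamM) (hlamR : 0 < lamR) {PM β η : ℝ} (hPM : 0 < PM)
    (hβ : 0 < β) :
    (∀ᵐ ω ∂(P[|servedByMBS XM XR]), 0 < signal S PM β η XM g0 ω) ∧
    Integrable (fun ω => Real.log (signal S PM β η XM g0 ω)) (P[|servedByMBS XM XR]) ∧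
    ∫ ω, Real.log (signal S PM β η XM g0 ω) ∂(P[|servedByMBS XM XR]) =
      Real.log (PM / S * β) + psi ((N : ℝ) - S + 1)
        - η / 2 * (psi 1 - Real.log (Real.pi * (lamR + lamM))) := by
  have hS0 : (0 : ℝ) < S := by exact_mod_cast hS
  have hK : (0 : ℝ) < (N : ℝ) - S + 1 := by
    have : (S : ℝ) ≤ N := by exact_mod_cast hSN
    linarith
  have hΛ : 0 < lamM + lamR := by positivity
  have hprob := isProbabilityMeasure_cond_served h.hpppM h.hpppR hlamM hlamR h.indepFun_tiers
  have hT := measurable_contactArea h.hpppM.measurable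
  have hmT := map_contactArea_cond h.hpppM h.hpppR hlamM hlamR h.indepFun_tiers
  have hmg := h.map_g0_cond hlamM hlamR
  set Q := P[|servedByMBS XM XR] with hQ
  have hlog := Real.measurable_log.aestronglyMeasurable (μ := Q.map g0)
  have hlog' := Real.measurable_log.aestronglyMeasurable (μ := Q.map (contactArea XM))
  obtain ⟨hg1, hg2⟩ := integrable_log_gammaMeasure hK
  obtain ⟨hT1, hT2⟩ := integrable_log_expMeasure hΛ
  have hgpos := ae_gammaMeasure_pos ((N : ℝ) - S + 1)
  have hTpos := ae_expMeasure_pos (lamM + lamR)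
  rw [← hmg] at hg1 hg2 hgpos
  rw [← hmT] at hT1 hT2 hTpos
  rw [integral_map h.measurable_g0.aemeasurable hlog] at hg2
  rw [integral_map hT.aemeasurable hlog'] at hT2
  replace hg1 : Integrable (fun ω => Real.log (g0 ω)) Q :=
    (integrable_map_measure hlog h.measurable_g0.aemeasurable).1 hg1
  replace hT1 : Integrable (fun ω => Real.log (contactArea XM ω)) Q :=
    (integrable_map_measure hlog' hT.aemeasurable).1 hT1
  replace hgpos := ae_of_ae_map h.measurable_g0.aemeasurable hgpos
  replace hTpos := ae_of_ae_map hT.aemeasurable hTpos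
  have hsig : ∀ ω, signal S PM β η XM g0 ω =
      PM / S * g0 ω * β * (contactArea XM ω / Real.pi) ^ (-(η / 2)) := fun ω => by
    rw [signal, norm_rpow_neg_eq, contactArea]
  have hpi := Real.pi_pos
  -- Almost surely gain and contact area are positive, so the logarithm of the signal splits into a
  -- constant, a log-gamma and a log-exponential term.
  have he : (fun ω => Real.log (PM / S * β) + Real.log (g0 ω) -
      η / 2 * (Real.log (contactArea XM ω) - Real.log Real.pi)) =ᵐ[Q]
      fun ω => Real.log (signal S PM β η XM g0 ω) := by
    filter_upwards [hgpos, hTpos] with ω h1 h2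
    rw [hsig, mul_right_comm (PM / S),
      Real.log_mul (x := PM / S * β * g0 ω) (by positivity) (by positivity),
      Real.log_mul (x := PM / S * β) (y := g0 ω) (by positivity) (by positivity), Real.log_rpow (by positivity),
      Real.log_div (by positivity) (by positivity)]
    ring
  have hi1 : Integrable (fun ω => Real.log (PM / S * β) + Real.log (g0 ω)) Q :=
    (integrable_const _).add hg1
  have hi2 : Integrable (fun ω => Real.log (contactArea XM ω) - Real.log Real.pi) Q :=
    hT1.sub (integrable_const _)
  refine ⟨?_, (hi1.sub (hi2.const_mul _)).congr he, ?_⟩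
  · filter_upwards [hgpos, hTpos] with ω h1 h2
    rw [hsig]
    positivity
  · rw [← integral_congr_ae he, integral_sub hi1 (hi2.const_mul _), integral_const_mul,
      integral_add (integrable_const _) hg1, integral_sub hT1 (integrable_const _), hg2, hT2,
      Real.log_mul hpi.ne' (by positivity), add_comm lamR]
    simp only [integral_const, probReal_univ, smul_eq_mul, one_mul]
    ring

end IsDownlink

lemma measurable_interfM {S : ℕ} {PM β η : ℝ} {XM : ℕ → Ω → Plane} {gM : ℕ → Ω → ℝ}
    (hX : ∀ n, Measurable (XM n)) (hg : ∀ n, Measurable (gM n)) :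
    Measurable (interfM S PM β η XM gM) :=
  Measurable.tsum fun n => Measurable.ite
    (measurableSet_eq_fun measurable_const (measurable_nearest hX)) measurable_const
    ((((hg n).const_mul _).mul_const _).mul ((hX n).norm.pow_const _)).ennreal_ofReal

lemma measurable_interfR {PR β η : ℝ} {XR : ℕ → Ω → Plane} {gR : ℕ → Ω → ℝ}
    (hX : ∀ n, Measurable (XR n)) (hg : ∀ n, Measurable (gR n)) :
    Measurable (interfR PR β η XR gR) :=
  Measurable.tsum fun n =>
    ((((hg n).const_mul _).mul_const _).mul ((hX n).norm.pow_const _)).ennreal_ofReal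

lemma meanInterf_nonneg {Ptx β lam η lamM lamR : ℝ} (hP : 0 < Ptx) (hβ : 0 < β)
    (hlam : 0 < lam) (hη : 2 < η ∧ η < 4) (hM : 0 < lamM) (hR : 0 < lamR) :
    0 ≤ meanInterf Ptx β lam η lamM lamR := by
  have h1 := Real.Gamma_pos_of_pos (show 0 < 2 - η / 2 by linarith [hη.2])
  have h2 : 0 < η - 2 := by linarith [hη.1]
  have hpi := Real.pi_pos
  unfold meanInterf
  positivity

end HetCRAN

end

/-! ### Assembly: mean interference and signal log-moment inserted into the Jensen bound. -/

theorem theorem3 {Ω : Type*} [MeasurableSpace Ω] (P : Measure Ω) [IsProbabilityMeasure P]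
    (N S : ℕ) (hS : 1 ≤ S) (hSN : S ≤ N)
    (lamM lamR : ℝ) (hlamM : 0 < lamM) (hlamR : 0 < lamR)
    (PM PR β Bo N1 : ℝ) (hPM : 0 < PM) (hPR : 0 < PR) (hβ : 0 < β) (hBo : 0 < Bo) (hN1 : 0 < N1)
    (ηM ηR : ℝ) (hηM : 2 < ηM ∧ ηM < 4) (hηR : 2 < ηR ∧ ηR < 4)
    (XM XR : ℕ → Ω → HetCRAN.Plane) (g0 : Ω → ℝ) (gM gR : ℕ → Ω → ℝ)
    (hmodel : HetCRAN.IsDownlink P N S lamM lamR XM XR g0 gM gR) :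
    -- the ergodic capacity is an expectation that exists, given that the user is served by an MBS
    Integrable (HetCRAN.rate S PM PR β ηM ηR (Bo * N1) XM XR g0 gM gR)
      (P[|HetCRAN.servedByMBS XM XR]) ∧
    -- the mean interference powers from MBSs and RRHs
    ∫⁻ ω, HetCRAN.interfM S PM β ηM XM gM ω ∂(P[|HetCRAN.servedByMBS XM XR]) =
      ENNReal.ofReal (HetCRAN.meanInterf PM β lamM ηM lamM lamR) ∧
    ∫⁻ ω, HetCRAN.interfR PR β ηR XR gR ω ∂(P[|HetCRAN.servedByMBS XM XR]) =
      ENNReal.ofReal (HetCRAN.meanInterf PR β lamR ηR lamM lamR) ∧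
    -- the closed-form lower bound for the ergodic capacity
    Real.logb 2 (1 + Real.exp
      ((Real.log (PM / S * β) + HetCRAN.psi ((N : ℝ) - S + 1)
          - ηM / 2 * (HetCRAN.psi 1 - Real.log (Real.pi * (lamR + lamM))))
        + -Real.log (HetCRAN.meanInterf PM β lamM ηM lamM lamR
            + HetCRAN.meanInterf PR β lamR ηR lamM lamR + Bo * N1)))
      ≤ ∫ ω, HetCRAN.rate S PM PR β ηM ηR (Bo * N1) XM XR g0 gM gR ω
          ∂(P[|HetCRAN.servedByMBS XM XR]) := by
  have hIM := hmodel.lintegral_interfM hS hlamM hlamR hPM hβ hηM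
  have hIR := hmodel.lintegral_interfR hlamM hlamR hPR hβ hηR
  obtain ⟨hs, hls, hlse⟩ := hmodel.log_signal_integral (η := ηM) hS hSN hlamM hlamR hPM hβ
  have hprob := HetCRAN.isProbabilityMeasure_cond_served hmodel.hpppM hmodel.hpppR hlamM hlamR
    hmodel.indepFun_tiers
  set Q := P[|HetCRAN.servedByMBS XM XR]
  have hmM := HetCRAN.measurable_interfM (S := S) (PM := PM) (β := β) (η := ηM)
    hmodel.hpppM.measurable hmodel.measurable_gM
  have hmR := HetCRAN.measurable_interfR (PR := PR) (β := β) (η := ηR)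
    hmodel.hpppR.measurable hmodel.measurable_gR
  have hc : 0 < Bo * N1 := mul_pos hBo hN1
  have hM0 := HetCRAN.meanInterf_nonneg hPM hβ hlamM hηM hlamM hlamR
  have hR0 := HetCRAN.meanInterf_nonneg hPR hβ hlamR hηR hlamM hlamR
  set W : Ω → ℝ≥0∞ := fun ω => HetCRAN.interfM S PM β ηM XM gM ω +
    HetCRAN.interfR PR β ηR XR gR ω + ENNReal.ofReal (Bo * N1) with hW
  have hWm : Measurable W := (hmM.add hmR).add measurable_const
  have hWint : ∫⁻ ω, W ω ∂Q = ENNReal.ofReal (HetCRAN.meanInterf PM β lamM ηM lamM lamR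
      + HetCRAN.meanInterf PR β lamR ηR lamM lamR + Bo * N1) := by
    rw [hW, lintegral_add_left (f := fun ω => HetCRAN.interfM S PM β ηM XM gM ω +
      HetCRAN.interfR PR β ηR XR gR ω) (hmM.add hmR), lintegral_add_left hmM, hIM, hIR, lintegral_const,
      measure_univ, mul_one, ENNReal.ofReal_add (by positivity) hc.le, ENNReal.ofReal_add hM0 hR0]
  have hWtop : ∫⁻ ω, W ω ∂Q ≠ ∞ := by
    rw [hWint]
    exact ENNReal.ofReal_ne_top
  -- A finite mean makes the total power finite almost surely, so the default value of `toReal` at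
  -- infinity does not matter.
  have hWfin : ∀ᵐ ω ∂Q, W ω < ∞ := ae_lt_top hWm hWtop
  have hwint : ∫ ω, (W ω).toReal ∂Q = HetCRAN.meanInterf PM β lamM ηM lamM lamR
      + HetCRAN.meanInterf PR β lamR ηR lamM lamR + Bo * N1 := by
    rw [integral_toReal hWm.aemeasurable hWfin, hWint, ENNReal.toReal_ofReal (by positivity)]
  have hcW : ∀ᵐ ω ∂Q, Bo * N1 ≤ (W ω).toReal := by
    filter_upwards [hWfin] with ω hω
    rw [← ENNReal.ofReal_le_iff_le_toReal hω.ne]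
    exact le_add_self
  have hsm : Measurable (HetCRAN.signal S PM β ηM XM g0) := by
    have : HetCRAN.signal S PM β ηM XM g0 = fun ω => PM / S * g0 ω * β *
        (HetCRAN.contactArea XM ω / Real.pi) ^ (-(ηM / 2)) := by
      ext ω
      rw [HetCRAN.signal, HetCRAN.norm_rpow_neg_eq, HetCRAN.contactArea]
    rw [this]
    have h1 := HetCRAN.measurable_contactArea hmodel.hpppM.measurable
    have h2 := hmodel.measurable_g0
    fun_prop
  have hcap := HetCRAN.logb_one_add_exp_le_integral
    (integrable_toReal_of_lintegral_ne_top hWm.aemeasurable hWtop) hc hcW hsm.aemeasurable hs hls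
  rw [hlse, hwint] at hcap
  exact ⟨hcap.1, hIM, hIR, hcap.2⟩
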